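/- Let $|\alpha_0|,|\alpha_1|<1$, $\rho>0$, $\sigma_{\max}^2\ge 1$ and $m\ge1$. Let $\arg\min_T$ be taken over integers $T\ge1$, with an arbitrary but fixed tie-breaking rule. For $k\in\{0,1\}$ put $$T_k^{\rm genie}=\arg\min_{T}\Big\{\sum_{\ell=1}^{T-1}(1-\alpha_k^{2\ell})+\frac{\rho}{T}\Big\},\qquad d_k^{\rm genie}=\frac1{T_k^{\rm genie}}\sum_{\ell=1}^{T_k^{\rm genie}-1}(1-\alpha_k^{2\ell}),$$ $$R=\frac1{2T_0^{\rm genie}}+\frac1{2T_1^{\rm genie}},\qquad D=\frac{d_0^{\rm genie}+d_1^{\rm genie}}2 .$$ **Signal.** $\theta_t\in\{0,1\}$ $(t\ge 0)$ is a Markov chain with $p_{01}=p_{10}=p\in(0,1]$, and $X(t+1)=\alpha_{\theta_t}X(t)+Z_{\theta_t}(t+1)$, where $Z_k(t)\sim\mathcal N(0,1-\alpha_k^2)$, the pairs $(Z_0(t),Z_1(t))$ are independent over $t$, the noise, the chain and $X(0)$ are independent, and $\mathbb E X(0)^2=1$. **Scheme.** The first $m$ sampling times $t_0<\dots<t_{m-1}$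 are prescribed integers. For $i\ge m-1$ let $\theta_{S_i}=k$ if $\theta_s=k$ for all $t_{i-m+1}\le s\le t_i$ ($k=0,1$) and $\theta_{S_i}=2$ otherwise; let $\hat\theta_i$ be an estimate of $\theta_{S_i}$ with error probability $P_e(i)=\Pr(\hat\theta_i\ne\theta_{S_i})$. The greedy scheme takes $t_{i+1}=t_i+\arg\min_T c_i(T\mid\hat\theta_i)$, where $$c_i(T\mid k)=(1-P_e(i))\sum_{\ell=1}^{T-1}(1-\alpha_k^{2\ell})+P_e(i)(T-1)\sigma_{\max}^2+\frac\rho T\quad(k=0,1),\qquad c_i(T\mid 2)=(T-1)\sigma_{\max}^2+\frac\rho T .$$ It is *genie-aided* if $P_e(i)=0$ for all $i\ge m-1$. The reconstruction $\widehat X$ equals $X$ at sampling times. At a time $s$ with $t_i<s<t_{i+1}$, $i\ge m-1$, it is a linear combination of $X(t_i),\dots,X(t_{i-m+1})$ whose weights depend only on $\hat\theta_i$, $s-t_i$ and the differences $t_i-t_{i-j}$; for $\hat\theta_i=k\in\{0,1\}$ they minimize the mean square prediction error for the stationary process with autocorrelation $\alpha_k^{|h|}$ (generalized linear prediction), and for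 $\hat\theta_i=2$ they are arbitrary. Before $t_{m-1}$, at non-sampling times, $\widehat X=0$. **Claim 1.** With $P_e^{\rm low}=P_e^{\rm up}=0$ the general rate and distortion bounds $$\frac1{2T_0^{\rm up}}+\frac1{2T_1^{\rm up}},\quad \frac1{2T_0^{\rm low}}+\frac1{2T_1^{\rm low}},\quad \frac{d_0^{\rm low}+d_1^{\rm low}}2,\quad \frac{d_0^{\rm up}+d_1^{\rm up}}2$$ equal $R,R,D,D$, respectively. Here $T_k^{\rm low}$ (resp. $T_k^{\rm up}$) is the $\arg\min$ of $(1-P)\sum_{\ell=1}^{T-1}(1-\alpha_k^{2\ell})+P(T-1)\sigma_{\max}^2+\rho/T$ with $P=P_e^{\rm up}$ (resp. $P=P_e^{\rm low}$), and $d_k^{x}=\frac1{T_k^{x}}\{(1-P_e^{x})\sum_{\ell=1}^{T_k^{x}-1}(1-\alpha_k^{2\ell})+P_e^{x}(T_k^{x}-1)\sigma_{\max}^2\}$ for $x\in\{{\rm low},{\rm up}\}$. **Claim 2.** The pair $(R,D)$ is achievable by the genie-aided scheme when the chain is unlikely to move during an increment and the time horizon is large. Precisely, fix $\alpha_0,\alpha_1,\rho,\sigma_{\max}^2,m$,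 the tie-breaking rule and the prediction weights, and let $T_{\rm up}$ bound the increments $\arg\min_T c(T\mid k)$, $k=0,1,2$, at $P_e=0$. For every $\varepsilon>0$ there is $\delta>0$ such that, for every $p\in(0,1]$ with $(1-p)^{T_{\rm up}-1}>1-\delta$ and all prescribed initial sampling times, there is $N$ such that for all $n\ge N$, every signal and every genie-aided scheme as above, the rate $R_n=\frac1n\#\{i:t_i<n\}$ and the distortion $D_n=\frac1n\sum_{s<n}(X(s)-\widehat X(s))^2$ are integrable and $$\mathbb E\,|R_n-R|\le\varepsilon,\qquad |\mathbb E\,D_n-D|\le\varepsilon .$$ -/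

import Mathlib

open MeasureTheory ProbabilityTheory

universe u

noncomputable section

/-! ### Costs and increments of the greedy scheme -/

/-- `sel` is an `arg min` over the integers `T ≥ 1`, with some fixed rule for breaking ties:
whenever `f` attains its minimum over `T ≥ 1`, it is attained at `sel f`. -/
def IsArgMinRule (sel : (ℕ → ℝ) → ℕ) : Prop :=
  ∀ f : ℕ → ℝ, (∃ T, 1 ≤ T ∧ ∀ T', 1 ≤ T' → f T ≤ f T') →
    1 ≤ sel f ∧ ∀ T', 1 ≤ T' → f (sel f) ≤ f T'

/-- `∑_{ℓ=1}^{T-1} (1 - a^{2ℓ})`, the expected distortion over one sampling increment `T`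
when the AR coefficient is `a`. -/
def arDistortion (a : ℝ) (T : ℕ) : ℝ := ∑ l ∈ Finset.Icc 1 (T - 1), (1 - a ^ (2 * l))

/-- Expected distortion over one increment when the chain state is estimated with error
probability `Pe`; `s2` is the maximal prediction error variance `σ_max²`. -/
def estDistortion (a Pe s2 : ℝ) (T : ℕ) : ℝ :=
  (1 - Pe) * arDistortion a T + Pe * ((T : ℝ) - 1) * s2

/-- Sampling state cost given that the estimated chain state has AR coefficient `a`. -/
def markovCost (a Pe s2 ρ : ℝ) (T : ℕ) : ℝ := estDistortion a Pe s2 T + ρ / T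

/-- Sampling state cost given an estimate in `{0, 1, 2}`; the value `2` means that a transition
of the chain took place during the sampling state. -/
def greedyCost (α : Fin 2 → ℝ) (Pe s2 ρ : ℝ) (k : Fin 3) (T : ℕ) : ℝ :=
  match k with
  | 0 => markovCost (α 0) Pe s2 ρ T
  | 1 => markovCost (α 1) Pe s2 ρ T
  | 2 => ((T : ℝ) - 1) * s2 + ρ / T

/-- The increment chosen by the greedy scheme. -/
def greedyStep (sel : (ℕ → ℝ) → ℕ) (α : Fin 2 → ℝ) (Pe s2 ρ : ℝ) (k : Fin 3) : ℕ :=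
  sel (greedyCost α Pe s2 ρ k)

/-! ### Bounds on rate and distortion when `PeLow ≤ P_e ≤ PeUp` -/

/-- `T^low`, computed from the upper bound on the error probability. -/
def stepLow (sel : (ℕ → ℝ) → ℕ) (a PeUp s2 ρ : ℝ) : ℕ := sel (markovCost a PeUp s2 ρ)

/-- `T^up`, computed from the lower bound on the error probability. -/
def stepUp (sel : (ℕ → ℝ) → ℕ) (a PeLow s2 ρ : ℝ) : ℕ := sel (markovCost a PeLow s2 ρ)

/-- `d^low`. -/
def distLow (sel : (ℕ → ℝ) → ℕ) (a PeLow PeUp s2 ρ : ℝ) : ℝ :=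
  1 / (stepLow sel a PeUp s2 ρ : ℝ) * estDistortion a PeLow s2 (stepLow sel a PeUp s2 ρ)

/-- `d^up`. -/
def distUp (sel : (ℕ → ℝ) → ℕ) (a PeLow PeUp s2 ρ : ℝ) : ℝ :=
  1 / (stepUp sel a PeLow s2 ρ : ℝ) * estDistortion a PeUp s2 (stepUp sel a PeLow s2 ρ)

/-- Lower bound on the rate. -/
def rateLowerBound (sel : (ℕ → ℝ) → ℕ) (α : Fin 2 → ℝ) (PeLow s2 ρ : ℝ) : ℝ :=
  1 / (2 * (stepUp sel (α 0) PeLow s2 ρ : ℝ)) + 1 / (2 * (stepUp sel (α 1) PeLow s2 ρ : ℝ))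

/-- Upper bound on the rate. -/
def rateUpperBound (sel : (ℕ → ℝ) → ℕ) (α : Fin 2 → ℝ) (PeUp s2 ρ : ℝ) : ℝ :=
  1 / (2 * (stepLow sel (α 0) PeUp s2 ρ : ℝ)) + 1 / (2 * (stepLow sel (α 1) PeUp s2 ρ : ℝ))

/-- Lower bound on the distortion. -/
def distLowerBound (sel : (ℕ → ℝ) → ℕ) (α : Fin 2 → ℝ) (PeLow PeUp s2 ρ : ℝ) : ℝ :=
  distLow sel (α 0) PeLow PeUp s2 ρ / 2 + distLow sel (α 1) PeLow PeUp s2 ρ / 2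

/-- Upper bound on the distortion. -/
def distUpperBound (sel : (ℕ → ℝ) → ℕ) (α : Fin 2 → ℝ) (PeLow PeUp s2 ρ : ℝ) : ℝ :=
  distUp sel (α 0) PeLow PeUp s2 ρ / 2 + distUp sel (α 1) PeLow PeUp s2 ρ / 2

/-! ### The rate-distortion pair with known chain state -/

/-- `T^genie = arg min_T ∑_{ℓ=1}^{T-1} (1 - a^{2ℓ}) + ρ / T`. -/
def genieStep (sel : (ℕ → ℝ) → ℕ) (a ρ : ℝ) : ℕ :=
  sel fun T => ∑ l ∈ Finset.Icc 1 (T - 1), (1 - a ^ (2 * l)) + ρ / T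

/-- `d^genie = (1 / T^genie) ∑_{ℓ=1}^{T^genie-1} (1 - a^{2ℓ})`. -/
def genieDist (sel : (ℕ → ℝ) → ℕ) (a ρ : ℝ) : ℝ :=
  1 / (genieStep sel a ρ : ℝ) *
    ∑ l ∈ Finset.Icc 1 (genieStep sel a ρ - 1), (1 - a ^ (2 * l))

def genieRate (sel : (ℕ → ℝ) → ℕ) (α : Fin 2 → ℝ) (ρ : ℝ) : ℝ :=
  1 / (2 * (genieStep sel (α 0) ρ : ℝ)) + 1 / (2 * (genieStep sel (α 1) ρ : ℝ))

def genieDistortion (sel : (ℕ → ℝ) → ℕ) (α : Fin 2 → ℝ) (ρ : ℝ) : ℝ :=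
  genieDist sel (α 0) ρ / 2 + genieDist sel (α 1) ρ / 2

/-! ### Generalized linear prediction -/

/-- `E |Y(t) - ∑_j v_j Y(t - τ_j)|²` for a stationary process `Y` with autocorrelation `r`. -/
def predErrorPower {m : ℕ} (r : ℤ → ℝ) (τ : Fin m → ℕ) (v : Fin m → ℝ) : ℝ :=
  r 0 - 2 * ∑ j, v j * r (τ j) + ∑ i, ∑ j, v i * v j * r ((τ i : ℤ) - (τ j : ℤ))

/-- Autocorrelation of the unit-power stationary AR(1) process with coefficient `a`. -/
def arAutocorr (a : ℝ) (i : ℤ) : ℝ := a ^ i.natAbs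

/-- `v off l` holds the weights with which the value `l` steps after the latest sample is predicted
from `m` samples, the `j`-th of which lies `off j` steps before the latest one. The weights are
those of the generalized linear prediction filter of the AR(1) process with coefficient `a`
if they minimize the mean square error. -/
def IsGLPFilter {m : ℕ} (a : ℝ) (v : (Fin m → ℕ) → ℕ → Fin m → ℝ) : Prop :=
  ∀ off : Fin m → ℕ, StrictMono off → ∀ l : ℕ, 1 ≤ l → ∀ v' : Fin m → ℝ,
    predErrorPower (arAutocorr a) (fun j => l + off j) (v off l) ≤
      predErrorPower (arAutocorr a) (fun j => l + off j) v'

/-! ### The signal model -/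

/-- `θ` is a two-state Markov chain with `p₀₁ = p₁₀ = p` (any initial law). -/
structure IsSymmetricChain {Ω : Type u} [MeasurableSpace Ω] (P : Measure Ω) (p : ℝ)
    (θ : ℕ → Ω → Fin 2) : Prop where
  measurable : ∀ t, Measurable (θ t)
  transition : ∀ (n : ℕ) (s : ℕ → Fin 2),
    P.real {ω | ∀ i, i ≤ n + 1 → θ i ω = s i} =
      P.real {ω | ∀ i, i ≤ n → θ i ω = s i} * (if s (n + 1) = s n then 1 - p else p)

/-- The Markovian signal `X(t+1) = α_{θ_t} X(t) + Z_{θ_t}(t+1)` of unit power, where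
`Z_k(t) ∼ N(0, 1 - α_k²)`, the noise is independent over time, and the noise, the chain and the
initial value are independent. -/
structure IsMarkovianSignal {Ω : Type u} [MeasurableSpace Ω] (P : Measure Ω) (α : Fin 2 → ℝ)
    (θ : ℕ → Ω → Fin 2) (Z : Fin 2 → ℕ → Ω → ℝ) (X : ℕ → Ω → ℝ) : Prop where
  measurable_noise : ∀ k t, Measurable (Z k t)
  noise_law : ∀ k t, P.map (Z k t) = gaussianReal 0 (1 - α k ^ 2).toNNReal
  noise_indep : iIndepFun (fun t ω (k : Fin 2) => Z k t ω) P
  measurable_init : Measurable (X 0)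
  memLp_init : MemLp (X 0) 2 P
  power_init : ∫ ω, X 0 ω ^ 2 ∂P = 1
  init_indep_chain : IndepFun (X 0) (fun ω t => θ t ω) P
  noise_indep_rest : IndepFun (fun ω (k : Fin 2) t => Z k t ω) (fun ω => (X 0 ω, fun t => θ t ω)) P
  recursion : ∀ t ω, X (t + 1) ω = α (θ t ω) * X t ω + Z (θ t ω) (t + 1) ω

/-! ### The sampling scheme -/

open Classical in
/-- The state of the chain during the time window `[a, b]`: `0` or `1` if the chain stays
there, `2` if there is a transition. -/
def windowState (s : ℕ → Fin 2) (a b : ℕ) : Fin 3 :=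
  if ∀ i ∈ Finset.Icc a b, s i = 0 then 0
  else if ∀ i ∈ Finset.Icc a b, s i = 1 then 1
  else 2

/-- The chain state during the `i`-th sampling state, formed by the `m` most recent samples,
at times `t_{i-m+1}, …, t_i` (meaningful for `i ≥ m - 1`). -/
def samplingState {Ω : Type u} (m : ℕ) (θ : ℕ → Ω → Fin 2) (t : ℕ → Ω → ℕ) (i : ℕ) (ω : Ω) :
    Fin 3 :=
  windowState (fun s => θ s ω) (t (i + 1 - m) ω) (t i ω)

/-- `P_e` of the `i`-th sampling state: the probability that the estimate `θhat i` is wrong. -/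
def estError {Ω : Type u} [MeasurableSpace Ω] (P : Measure Ω) (m : ℕ) (θ : ℕ → Ω → Fin 2)
    (t : ℕ → Ω → ℕ) (θhat : ℕ → Ω → Fin 3) (i : ℕ) : ℝ :=
  P.real {ω | θhat i ω ≠ samplingState m θ t i ω}

/-- The greedy scheme of order `m` with estimates `θhat` and sampling times `t`. The first `m`
sampling times are prescribed by `t₀`; afterwards the next increment minimizes the sampling state
cost given the estimate. -/
structure IsGreedyScheme {Ω : Type u} [MeasurableSpace Ω] (P : Measure Ω) (sel : (ℕ → ℝ) → ℕ)
    (α : Fin 2 → ℝ) (s2 ρ : ℝ) (m : ℕ) (t₀ : Fin m → ℕ) (θ : ℕ → Ω → Fin 2)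
    (θhat : ℕ → Ω → Fin 3) (t : ℕ → Ω → ℕ) : Prop where
  measurable_est : ∀ i, Measurable (θhat i)
  init : ∀ (i : Fin m) (ω : Ω), t i ω = t₀ i
  step : ∀ i, m ≤ i + 1 → ∀ ω,
    t (i + 1) ω = t i ω + greedyStep sel α (estError P m θ t θhat i) s2 ρ (θhat i ω)

/-- The index of the latest sample at or before time `s`, for strictly increasing sampling
times `t` with `t 0 ≤ s`. -/
def latestIndex (t : ℕ → ℕ) (s : ℕ) : ℕ := Nat.findGreatest (fun i => t i ≤ s) s

open Classical in
/-- Causal reconstruction: exact at sampling times, and otherwise a linear prediction from the `m`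
most recent samples with weights `w k`, `k` the estimated chain state. Before `m` samples
are available, the prediction is `0`. -/
def reconstruction {Ω : Type u} {m : ℕ} (w : Fin 3 → (Fin m → ℕ) → ℕ → Fin m → ℝ)
    (θhat : ℕ → Ω → Fin 3) (t : ℕ → Ω → ℕ) (X : ℕ → Ω → ℝ) (s : ℕ) (ω : Ω) : ℝ :=
  let i := latestIndex (fun j => t j ω) s
  if ∃ j, t j ω = s then X s ω
  else if t (m - 1) ω ≤ s then
    ∑ j : Fin m, w (θhat i ω) (fun j' => t i ω - t (i - j') ω) (s - t i ω) j * X (t (i - j) ω) ω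
  else 0

open Classical in
/-- Number of samples per unit of time, over the times `0, …, n - 1`. -/
def samplingRate {Ω : Type u} (t : ℕ → Ω → ℕ) (n : ℕ) (ω : Ω) : ℝ :=
  (((Finset.range n).filter fun s => ∃ j, t j ω = s).card : ℝ) / n

/-- Squared reconstruction error per unit of time, over the times `0, …, n - 1`. -/
def sqDistortion {Ω : Type u} (X Xhat : ℕ → Ω → ℝ) (n : ℕ) (ω : Ω) : ℝ :=
  (∑ s ∈ Finset.range n, (X s ω - Xhat s ω) ^ 2) / n

end

/-! Claim 1 is an unfolding at error probability zero. For Claim 2, fix a path of the chain. With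
error-free estimates the sampling times are a causal, deterministic function of the path
(`IsGreedyRun`). If the chain rests in state `k` from the start of a sampling state to the end of
the next increment, that increment has length `T_k`, contains one sample, and has mean square errors
`1 - α_k^(2l)`, which add up to `T_k * d_k`. So both "sample indicator minus `1/T_{θ_u}`" and "mean
square error minus `d_{θ_u}`" sum to zero over it. Apart from a start of bounded length and the
increment cut off by the horizon, every other increment consists entirely of times within `m * Tup`
of a jump (`abs_sum_range_le`). By a union bound the expected fraction of such times is `O(p)`, and
`p` is small by assumption. If `Tup = 1` the assumption says nothing about `p`, but then every time
is sampled after the start and jumps are harmless.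

It remains to average `r (θ_u)` over time for a function `r` of the state. Such a function is its
mean over the two states plus a multiple of a sign, and sign correlations are multiplied by `1 - 2p`
at every step. The sum of `n` signs therefore has second moment at most `n * (1 + 1/p)`, for every
initial law and even for the periodic chain `p = 1`.

For the distortion, restrict the measure to the event that the chain follows a given path. This
event is independent of the noise, so `X` becomes autoregressive with deterministic coefficients and
constant power (`IsMarkovianSignal.hasARMoments`). On a constant stretch the optimal predictor has
the error of the one based on the latest sample alone (`HasARMoments.integral_sq_error_of_const`);
elsewhere a crude bound on the error suffices.

The order of quantifiers matters: `δ` precedes the initial times `t₀`. The constant in front of the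
disturbed fraction may thus involve only weights at offsets up to `m * Tup`; weights that depend on
`t₀` occur only in the start and are absorbed by `N`. -/

/-! ### Increments are well defined -/

/-- The selection rule is constrained only where a minimum is attained. Linear growth ensures this:
beyond `ρ / c + 1` the cost exceeds its value at `1`, so a finite range decides. -/
theorem IsArgMinRule.one_le {sel : (ℕ → ℝ) → ℕ} (hsel : IsArgMinRule sel) {f : ℕ → ℝ} {c ρ : ℝ}
    (hc : 0 < c) (h1 : f 1 ≤ ρ) (h : ∀ T : ℕ, 1 ≤ T → ((T : ℝ) - 1) * c ≤ f T) :
    1 ≤ sel f := by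
  refine (hsel f ?_).1
  obtain ⟨N, hN⟩ := exists_nat_gt (ρ / c)
  obtain ⟨T, hT, hmin⟩ := Finset.exists_min_image (Finset.Icc 1 (N + 1)) f ⟨1, by simp⟩
  refine ⟨T, (Finset.mem_Icc.1 hT).1, fun T' hT' => ?_⟩
  rcases le_or_gt T' (N + 1) with h' | h'
  · exact hmin T' (Finset.mem_Icc.2 ⟨hT', h'⟩)
  · have h2 := hmin 1 (by simp)
    have h3 := h T' hT'
    have h4 : (N : ℝ) + 1 < T' := by exact_mod_cast h'
    rw [div_lt_iff₀ hc] at hN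
    nlinarith

theorem mul_le_arDistortion {a : ℝ} (ha : |a| < 1) {T : ℕ} (hT : 1 ≤ T) :
    ((T : ℝ) - 1) * (1 - a ^ 2) ≤ arDistortion a T := by
  have h : ∑ _l ∈ Finset.Icc 1 (T - 1), (1 - a ^ 2) ≤ arDistortion a T := by
    refine Finset.sum_le_sum fun l hl => ?_
    have h1 : (a ^ 2) ^ l ≤ (a ^ 2) ^ 1 :=
      pow_le_pow_of_le_one (sq_nonneg a) ((sq_le_one_iff_abs_le_one a).2 ha.le)
        (Finset.mem_Icc.1 hl).1
    rw [pow_mul]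
    linarith
  rwa [Finset.sum_const, Nat.card_Icc, Nat.add_sub_cancel, nsmul_eq_mul, Nat.cast_sub hT,
    Nat.cast_one] at h

theorem one_sub_sq_pos {a : ℝ} (ha : |a| < 1) : 0 < 1 - a ^ 2 := by
  have := (sq_lt_one_iff_abs_lt_one a).2 ha
  linarith

theorem markovCost_zero (a s2 ρ : ℝ) :
    markovCost a 0 s2 ρ = fun T : ℕ => ∑ l ∈ Finset.Icc 1 (T - 1), (1 - a ^ (2 * l)) + ρ / T := by
  funext T
  simp [markovCost, estDistortion, arDistortion]

theorem greedyCost_castSucc (α : Fin 2 → ℝ) (Pe s2 ρ : ℝ) (k : Fin 2) :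
    greedyCost α Pe s2 ρ k.castSucc = markovCost (α k) Pe s2 ρ := by
  fin_cases k <;> rfl

theorem greedyStep_castSucc (sel : (ℕ → ℝ) → ℕ) (α : Fin 2 → ℝ) (s2 ρ : ℝ) (k : Fin 2) :
    greedyStep sel α 0 s2 ρ k.castSucc = genieStep sel (α k) ρ := by
  rw [greedyStep, greedyCost_castSucc, markovCost_zero, genieStep]

theorem one_le_genieStep {sel : (ℕ → ℝ) → ℕ} (hsel : IsArgMinRule sel) {a ρ : ℝ} (ha : |a| < 1)
    (hρ : 0 < ρ) : 1 ≤ genieStep sel a ρ := by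
  refine hsel.one_le (c := 1 - a ^ 2) (ρ := ρ) (one_sub_sq_pos ha) (by simp) fun T hT => ?_
  have h1 := mul_le_arDistortion ha hT
  have h2 : 0 ≤ ρ / T := by positivity
  rw [arDistortion] at h1
  linarith

theorem one_le_greedyStep {sel : (ℕ → ℝ) → ℕ} (hsel : IsArgMinRule sel) {α : Fin 2 → ℝ}
    (hα : ∀ k, |α k| < 1) {s2 ρ : ℝ} (hρ : 0 < ρ) (hs2 : 1 ≤ s2) (k : Fin 3) :
    1 ≤ greedyStep sel α 0 s2 ρ k := by
  induction k using Fin.lastCases with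
  | cast k => rw [greedyStep_castSucc]; exact one_le_genieStep hsel (hα k) hρ
  | last =>
    refine hsel.one_le (c := s2) (ρ := ρ) (by linarith) ?_ fun T hT => ?_
    · change ((1 : ℕ) - 1 : ℝ) * s2 + ρ / (1 : ℕ) ≤ ρ
      simp
    · change _ ≤ ((T : ℝ) - 1) * s2 + ρ / T
      have h2 : 0 ≤ ρ / T := by positivity
      linarith

theorem bounds_eq_genie (sel : (ℕ → ℝ) → ℕ) (α : Fin 2 → ℝ) (s2 ρ : ℝ) :
    rateLowerBound sel α 0 s2 ρ = genieRate sel α ρ ∧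
      rateUpperBound sel α 0 s2 ρ = genieRate sel α ρ ∧
      distLowerBound sel α 0 0 s2 ρ = genieDistortion sel α ρ ∧
      distUpperBound sel α 0 0 s2 ρ = genieDistortion sel α ρ := by
  simp [rateLowerBound, rateUpperBound, distLowerBound, distUpperBound, genieRate,
    genieDistortion, genieDist, distLow, distUp, stepLow, stepUp, markovCost_zero, genieStep,
    estDistortion, arDistortion]

/-- A step of length `T = genieStep` accumulates the distortion `T * genieDist`. -/
theorem sum_range_genieStep (sel : (ℕ → ℝ) → ℕ) {a ρ : ℝ} (hT : 1 ≤ genieStep sel a ρ) :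
    ∑ l ∈ Finset.range (genieStep sel a ρ), (1 - a ^ (2 * l)) =
      genieStep sel a ρ * genieDist sel a ρ := by
  have h0 : (genieStep sel a ρ : ℝ) ≠ 0 := by positivity
  rw [genieDist, ← mul_assoc, mul_one_div_cancel h0, one_mul]
  -- The term `l = 0`, the sampling time itself, is zero; dropping it turns the range into `Icc 1 (T
  -- - 1)`.
  obtain ⟨T, h⟩ : ∃ T, genieStep sel a ρ = T + 1 := ⟨_, (Nat.sub_add_cancel hT).symm⟩
  rw [h, Finset.sum_range_succ', Nat.add_sub_cancel, Finset.range_eq_Ico,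
    Finset.sum_Ico_add' (fun l => 1 - a ^ (2 * l)) 0 T 1]
  simp only [mul_zero, pow_zero, sub_self, add_zero, zero_add]
  exact Finset.sum_congr (by ext; simp) fun _ _ => rfl

/-! ### Deterministic runs of the scheme -/

/-- A run of the greedy scheme with error-free estimates `κ` along the path `σ` of the chain;
`T k` is the increment chosen for the estimate `k`. -/
structure IsGreedyRun {m : ℕ} (T : Fin 3 → ℕ) (t₀ : Fin m → ℕ) (σ : ℕ → Fin 2)
    (κ : ℕ → Fin 3) (τ : ℕ → ℕ) : Prop where
  init : ∀ i : Fin m, τ i = t₀ i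
  est : ∀ i, m ≤ i + 1 → κ i = windowState σ (τ (i + 1 - m)) (τ i)
  step : ∀ i, m ≤ i + 1 → τ (i + 1) = τ i + T (κ i)

theorem windowState_of_const {σ : ℕ → Fin 2} {a b : ℕ} (hab : a ≤ b) {k : Fin 2}
    (h : ∀ i, a ≤ i → i ≤ b → σ i = k) : windowState σ a b = k.castSucc := by
  have ha := h a le_rfl hab
  unfold windowState
  have h : ∀ i ∈ Finset.Icc a b, σ i = k := fun i hi =>
    h i (Finset.mem_Icc.1 hi).1 (Finset.mem_Icc.1 hi).2
  obtain rfl | rfl : k = 0 ∨ k = 1 := by fin_cases k <;> simp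
  · rw [if_pos h]; rfl
  · rw [if_neg, if_pos h]
    · rfl
    · intro h'
      have := h' a (Finset.mem_Icc.2 ⟨le_rfl, hab⟩)
      simp [ha] at this

theorem windowState_congr {σ σ' : ℕ → Fin 2} {a b : ℕ} (h : ∀ i ≤ b, σ i = σ' i) :
    windowState σ a b = windowState σ' a b := by
  unfold windowState
  congr 1
  · refine propext (forall₂_congr fun i hi => ?_)
    rw [h i (Finset.mem_Icc.1 hi).2]
  · congr 1
    refine propext (forall₂_congr fun i hi => ?_)
    rw [h i (Finset.mem_Icc.1 hi).2]

/-- The search bound in `latestIndex` is harmless because `i ≤ τ i ≤ u` for strictly increasing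
times. -/
theorem latestIndex_eq {τ : ℕ → ℕ} (hτ : StrictMono τ) {i u : ℕ} (h1 : τ i ≤ u)
    (h2 : u < τ (i + 1)) : latestIndex τ u = i := by
  rw [latestIndex, Nat.findGreatest_eq_iff]
  refine ⟨hτ.le_apply.trans h1, fun _ => h1, fun n hn _ hn' => ?_⟩
  have : τ (i + 1) ≤ τ n := hτ.monotone hn
  omega

theorem StrictMono.exists_le_lt_succ {τ : ℕ → ℕ} (hτ : StrictMono τ) {i₀ u : ℕ} (h : τ i₀ ≤ u) :
    ∃ i, i₀ ≤ i ∧ τ i ≤ u ∧ u < τ (i + 1) := by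
  refine ⟨Nat.findGreatest (fun i => τ i ≤ u) u, ?_, ?_, ?_⟩
  · exact Nat.le_findGreatest (hτ.le_apply.trans h) h
  · exact Nat.findGreatest_spec (P := fun i => τ i ≤ u) (hτ.le_apply.trans h) h
  · by_contra hc
    rw [not_lt] at hc
    have := Nat.le_findGreatest (P := fun i => τ i ≤ u) (hτ.le_apply.trans hc) hc
    omega

theorem StrictMono.not_exists_eq {τ : ℕ → ℕ} (hτ : StrictMono τ) {i u : ℕ} (h1 : τ i < u)
    (h2 : u < τ (i + 1)) : ¬ ∃ j, τ j = u := by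
  rintro ⟨j, rfl⟩
  have h3 := hτ.lt_iff_lt.1 h1
  have h4 := hτ.lt_iff_lt.1 h2
  omega

namespace IsGreedyRun

variable {m : ℕ} {T : Fin 3 → ℕ} {t₀ : Fin m → ℕ} {σ σ' : ℕ → Fin 2} {κ κ' : ℕ → Fin 3}
  {τ τ' : ℕ → ℕ}

theorem strictMono (h : IsGreedyRun T t₀ σ κ τ) (hT : ∀ k, 1 ≤ T k) (ht₀ : StrictMono t₀) :
    StrictMono τ := by
  refine strictMono_nat_of_lt_succ fun i => ?_
  rcases le_or_gt m (i + 1) with hi | hi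
  · rw [h.step i hi]
    have := hT (κ i)
    omega
  · have h1 := h.init ⟨i, by omega⟩
    have h2 := h.init ⟨i + 1, hi⟩
    simp only at h1 h2
    rw [h1, h2]
    exact ht₀ (by simp [Fin.lt_def])

/-- Causality: the estimate that fixes the next sampling time looks only at the chain up to the
current one. The induction is strong because the window reaches back `m` samples. -/
theorem congr_time (h : IsGreedyRun T t₀ σ κ τ) (h' : IsGreedyRun T t₀ σ' κ' τ')
    (hm : 1 ≤ m) (hτ : StrictMono τ) {n : ℕ} (hσ : ∀ i ≤ n, σ i = σ' i) (i : ℕ) (hi : τ i ≤ n) :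
    τ' i = τ i := by
  induction i using Nat.strong_induction_on with
  | _ i ih =>
    rcases lt_or_ge i m with him | him
    · exact (h'.init ⟨i, him⟩).trans (h.init ⟨i, him⟩).symm
    · cases i with
      | zero => omega
      | succ i =>
        have hlt : τ i < τ (i + 1) := hτ (Nat.lt_succ_self i)
        have h1 := ih i (Nat.lt_succ_self i) (by omega)
        have h2 : τ' (i + 1 - m) = τ (i + 1 - m) :=
          ih _ (by omega) ((hτ.monotone (by omega)).trans (hlt.le.trans hi))
        rw [h.step i him, h'.step i him, h.est i him, h'.est i him, h1, h2,
          windowState_congr fun j hj => hσ j (by omega)]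

/-- Applying causality in both directions also shows that samples later than `u` in one run stay
later in the other. -/
theorem congr_time_iff (h : IsGreedyRun T t₀ σ κ τ) (h' : IsGreedyRun T t₀ σ' κ' τ')
    (hm : 1 ≤ m) (hτ : StrictMono τ) (hτ' : StrictMono τ') {n : ℕ} (hσ : ∀ i ≤ n, σ i = σ' i)
    {u : ℕ} (hu : u ≤ n) (i : ℕ) : (τ' i ≤ u ↔ τ i ≤ u) ∧ (τ' i = u ↔ τ i = u) := by
  have h1 := h.congr_time h' hm hτ hσ i
  have h2 := h'.congr_time h hm hτ' (fun i hi => (hσ i hi).symm) i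
  omega

theorem congr_est (h : IsGreedyRun T t₀ σ κ τ) (h' : IsGreedyRun T t₀ σ' κ' τ')
    (hm : 1 ≤ m) (hτ : StrictMono τ) {n : ℕ} (hσ : ∀ i ≤ n, σ i = σ' i) {i : ℕ}
    (him : m ≤ i + 1) (hi : τ i ≤ n) : κ' i = κ i := by
  rw [h.est i him, h'.est i him, h.congr_time h' hm hτ hσ i hi,
    h.congr_time h' hm hτ hσ (i + 1 - m) ((hτ.monotone (by omega)).trans hi),
    windowState_congr fun j hj => hσ j (by omega)]

theorem time_add_le (h : IsGreedyRun T t₀ σ κ τ) {U : ℕ} (hU : ∀ k, T k ≤ U) {i : ℕ}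
    (hi : m ≤ i + 1) (j : ℕ) : τ (i + j) ≤ τ i + j * U := by
  induction j with
  | zero => simp
  | succ j ih =>
    rw [← add_assoc, h.step (i + j) (by omega), Nat.succ_mul]
    have := hU (κ (i + j))
    omega

end IsGreedyRun

open Classical in
/-- If `f` sums to zero over every increment of `τ` that is not entirely bad, then its partial sums
are controlled by the number of bad times. -/
theorem abs_sum_range_le {f : ℕ → ℝ} {τ : ℕ → ℕ} {bad : ℕ → Prop} {C C' : ℝ} {n i₀ s₀ U : ℕ}
    (hC : 0 ≤ C) (hC' : 0 ≤ C') (hτ : StrictMono τ) (hs₀ : τ i₀ ≤ s₀)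
    (hU : ∀ i, i₀ ≤ i → τ (i + 1) ≤ τ i + U)
    (h1 : ∀ u, u < n → u < τ i₀ → |f u| ≤ C') (h2 : ∀ u, u < n → τ i₀ ≤ u → |f u| ≤ C)
    (h3 : ∀ i, i₀ ≤ i → τ (i + 1) ≤ n → (∃ u, τ i ≤ u ∧ u < τ (i + 1) ∧ ¬ bad u) →
      ∑ u ∈ Finset.Ico (τ i) (τ (i + 1)), f u = 0) :
    |∑ u ∈ Finset.range n, f u| ≤
      C' * s₀ + C * (U + ∑ u ∈ Finset.range n, if bad u then 1 else 0) := by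
  have hb : ∀ s : Finset ℕ, 0 ≤ ∑ u ∈ s, if bad u then (1 : ℝ) else 0 := fun s =>
    Finset.sum_nonneg fun u _ => by split_ifs <;> norm_num
  -- The start, before `τ i₀`, where only the weaker bound `C'` is available.
  have hinit : ∀ k, k ≤ n → k ≤ τ i₀ → |∑ u ∈ Finset.range k, f u| ≤ C' * s₀ := by
    intro k hk hk'
    refine (Finset.abs_sum_le_sum_abs _ _).trans ?_
    refine (Finset.sum_le_card_nsmul _ _ C' fun u hu => ?_).trans ?_
    · have := Finset.mem_range.1 hu
      exact h1 u (by omega) (by omega)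
    · rw [Finset.card_range, nsmul_eq_mul, mul_comm]
      have : (k : ℝ) ≤ s₀ := by exact_mod_cast hk'.trans hs₀
      gcongr
  rcases le_total n (τ i₀) with hn | hn
  · refine (hinit n le_rfl hn).trans ?_
    have := hb (Finset.range n)
    exact le_add_of_nonneg_right (by positivity)
  obtain ⟨i, hi, hin, hni⟩ := hτ.exists_le_lt_succ hn
  -- Complete increments: one with a good time contributes zero, and in any other each time is bad
  -- and pays `C`.
  have key : ∀ j, i₀ ≤ j → τ j ≤ n → |∑ u ∈ Finset.Ico (τ i₀) (τ j), f u| ≤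
      C * ∑ u ∈ Finset.Ico (τ i₀) (τ j), if bad u then 1 else 0 := by
    intro j hj
    induction j, hj using Nat.le_induction with
    | base => simp
    | succ j hj ih =>
      intro hjn
      have hlt : τ j < τ (j + 1) := hτ (Nat.lt_succ_self j)
      have h0j := hτ.monotone hj
      rw [← Finset.sum_Ico_consecutive _ h0j hlt.le, ← Finset.sum_Ico_consecutive _ h0j hlt.le,
        mul_add]
      refine (abs_add_le _ _).trans (add_le_add (ih (by omega)) ?_)
      by_cases hbad : ∃ u, τ j ≤ u ∧ u < τ (j + 1) ∧ ¬ bad u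
      · rw [h3 j hj hjn hbad, abs_zero]
        exact mul_nonneg hC (hb _)
      · push Not at hbad
        refine (Finset.abs_sum_le_sum_abs _ _).trans ?_
        rw [Finset.mul_sum]
        refine Finset.sum_le_sum fun u hu => ?_
        obtain ⟨hu1, hu2⟩ := Finset.mem_Ico.1 hu
        rw [if_pos (hbad u hu1 hu2), mul_one]
        exact h2 u (by omega) (by omega)
  -- The increment cut off at `n` has at most `U` terms.
  have htail : |∑ u ∈ Finset.Ico (τ i) n, f u| ≤ C * U := by
    refine (Finset.abs_sum_le_sum_abs _ _).trans ?_
    refine (Finset.sum_le_card_nsmul _ _ C fun u hu => ?_).trans ?_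
    · obtain ⟨hu1, hu2⟩ := Finset.mem_Ico.1 hu
      exact h2 u hu2 ((hτ.monotone hi).trans hu1)
    · rw [Nat.card_Ico, nsmul_eq_mul, mul_comm]
      have := hU i hi
      have : ((n - τ i : ℕ) : ℝ) ≤ U := by exact_mod_cast (by omega)
      gcongr
  have h0i := hτ.monotone hi
  have hmono : ∑ u ∈ Finset.Ico (τ i₀) (τ i), (if bad u then (1 : ℝ) else 0) ≤
      ∑ u ∈ Finset.range n, if bad u then 1 else 0 := by
    refine Finset.sum_le_sum_of_subset_of_nonneg (fun u hu => ?_) fun u _ _ => ?_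
    · have := Finset.mem_Ico.1 hu
      exact Finset.mem_range.2 (by omega)
    · split_ifs <;> norm_num
  have hkey := key i hi hin
  have hmul := mul_le_mul_of_nonneg_left hmono hC
  rw [← Finset.sum_range_add_sum_Ico _ hn, ← Finset.sum_Ico_consecutive _ h0i hin]
  have ha := abs_add_le (∑ u ∈ Finset.range (τ i₀), f u)
    (∑ u ∈ Finset.Ico (τ i₀) (τ i), f u + ∑ u ∈ Finset.Ico (τ i) n, f u)
  have hb' := abs_add_le (∑ u ∈ Finset.Ico (τ i₀) (τ i), f u) (∑ u ∈ Finset.Ico (τ i) n, f u)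
  have hc := hinit (τ i₀) hn le_rfl
  rw [mul_add]
  linarith

/-- A time is disturbed if the chain jumps within distance `L` of it; when all increments are equal
to `1`, jumps do not matter. -/
def IsDisturbed (U L : ℕ) (σ : ℕ → Fin 2) (u : ℕ) : Prop :=
  2 ≤ U ∧ ∃ v, u ≤ v + L ∧ v ≤ u + L ∧ σ v ≠ σ (v + 1)

theorem eq_of_no_jump {σ : ℕ → Fin 2} {a b : ℕ} (h : ∀ v, a ≤ v → v < b → σ v = σ (v + 1))
    {v : ℕ} (hav : a ≤ v) (hvb : v ≤ b) : σ v = σ a := by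
  induction v, hav using Nat.le_induction with
  | base => rfl
  | succ v hv ih => rw [← h v hv (by omega), ih (by omega)]

namespace IsGreedyRun

variable {m : ℕ} {T : Fin 3 → ℕ} {t₀ : Fin m → ℕ} {σ : ℕ → Fin 2} {κ : ℕ → Fin 3}
  {τ : ℕ → ℕ}

/-- During an undisturbed increment, either all increments are `1`, or the chain is constant
from the beginning of the sampling state until the end of the increment. -/
theorem const_of_not_isDisturbed (h : IsGreedyRun T t₀ σ κ τ) (hm : 1 ≤ m) (hτ : StrictMono τ)
    {U : ℕ} (hU : ∀ k, T k ≤ U) {i u : ℕ} (hi : 2 * m ≤ i) (h1 : τ i ≤ u) (h2 : u < τ (i + 1))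
    (hu : ¬ IsDisturbed U (m * U) σ u) (hU2 : 2 ≤ U) :
    ∃ k : Fin 2, κ i = k.castSucc ∧ τ (i + 1) = τ i + T k.castSucc ∧
      ∀ v, τ (i + 1 - m) ≤ v → v ≤ τ (i + 1) → σ v = k := by
  -- As `2 * m ≤ i`, all `m` steps from `i + 1 - m` to `i + 1` are greedy, so this stretch has
  -- length at most `m * U`, and a jump inside it would disturb `u`.
  have hb := h.time_add_le hU (i := i + 1 - m) (by omega) m
  rw [show i + 1 - m + m = i + 1 by omega] at hb
  have h0 : τ (i + 1 - m) ≤ τ i := hτ.monotone (by omega)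
  have hc : ∀ v, τ (i + 1 - m) ≤ v → v ≤ τ (i + 1) → σ v = σ (τ (i + 1 - m)) := by
    intro v hv1 hv2
    refine eq_of_no_jump (b := τ (i + 1)) (fun w hw1 hw2 => ?_) hv1 hv2
    by_contra hne
    exact hu ⟨hU2, w, by omega, by omega, hne⟩
  have hk : κ i = (σ (τ (i + 1 - m))).castSucc := by
    rw [h.est i (by omega)]
    exact windowState_of_const h0 fun v hv1 hv2 => hc v hv1 (by omega)
  exact ⟨_, hk, by rw [h.step i (by omega), hk], hc⟩

end IsGreedyRun

/-! ### Second moments along a path of the chain -/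

/-- Independence tested against an indicator: moments of the noise or of the initial value survive
restriction to an event of the chain, up to its probability. -/
theorem ProbabilityTheory.IndepFun.setIntegral_preimage {Ω β γ : Type*} [MeasurableSpace Ω]
    [MeasurableSpace β] [MeasurableSpace γ] {P : Measure Ω} {f : Ω → β} {g : Ω → γ}
    (h : IndepFun f g P) (hf : Measurable f) (hg : Measurable g) {φ : β → ℝ} (hφ : Measurable φ)
    {B : Set γ} (hB : MeasurableSet B) :
    ∫ ω in g ⁻¹' B, φ (f ω) ∂P = P.real (g ⁻¹' B) * ∫ ω, φ (f ω) ∂P := by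
  have h1 := h.integral_fun_comp_mul_comp (f := φ) (g := B.indicator (fun _ => (1 : ℝ)))
    hf.aemeasurable hg.aemeasurable hφ.aestronglyMeasurable
    (measurable_const.indicator hB).aestronglyMeasurable
  have h2 : ∀ ω, φ (f ω) * B.indicator (fun _ => (1 : ℝ)) (g ω) =
      (g ⁻¹' B).indicator (fun ω => φ (f ω)) ω := fun ω => by
    by_cases hω : g ω ∈ B <;> simp [Set.indicator, hω]
  have h3 : ∀ ω, B.indicator (fun _ => (1 : ℝ)) (g ω) =
      (g ⁻¹' B).indicator (fun _ => (1 : ℝ)) ω := fun ω => rfl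
  simp_rw [h2, h3] at h1
  rw [integral_indicator (hg hB), integral_indicator (hg hB)] at h1
  rw [h1]
  simp [mul_comm]

/-- Second moments of an autoregressive process whose coefficient at time `c` is `α (σ c)`,
until time `M`. -/
structure HasARMoments {Ω : Type u} [MeasurableSpace Ω] (Q : Measure Ω) (α : Fin 2 → ℝ)
    (σ : ℕ → Fin 2) (X : ℕ → Ω → ℝ) (M : ℕ) : Prop where
  memLp : ∀ t, t ≤ M → MemLp (X t) 2 Q
  power : ∀ t, t ≤ M → ∫ ω, X t ω * X t ω ∂Q = Q.real Set.univ
  corr_succ : ∀ b c, b ≤ c → c < M →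
    ∫ ω, X b ω * X (c + 1) ω ∂Q = α (σ c) * ∫ ω, X b ω * X c ω ∂Q

section signal

variable {Ω : Type u} [MeasurableSpace Ω] {P : Measure Ω}
  {α : Fin 2 → ℝ} {θ : ℕ → Ω → Fin 2} {Z : Fin 2 → ℕ → Ω → ℝ} {X : ℕ → Ω → ℝ}

namespace IsMarkovianSignal

theorem memLp_noise (h : IsMarkovianSignal P α θ Z X) (k : Fin 2) (t : ℕ) :
    MemLp (Z k t) 2 P := by
  have h1 : MemLp id 2 (P.map (Z k t)) := by
    rw [h.noise_law]
    exact memLp_id_gaussianReal 2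
  exact (memLp_map_measure_iff aestronglyMeasurable_id (h.measurable_noise k t).aemeasurable).1 h1

theorem integral_noise (h : IsMarkovianSignal P α θ Z X) (k : Fin 2) (t : ℕ) :
    ∫ ω, Z k t ω ∂P = 0 := by
  have h1 := integral_map (f := id) (h.measurable_noise k t).aemeasurable
    (measurable_id.aestronglyMeasurable (μ := P.map (Z k t)))
  rw [h.noise_law] at h1
  exact h1.symm.trans integral_id_gaussianReal

theorem integral_noise_sq (h : IsMarkovianSignal P α θ Z X) (hα : ∀ k, |α k| < 1) (k : Fin 2)
    (t : ℕ) : ∫ ω, Z k t ω * Z k t ω ∂P = 1 - α k ^ 2 := by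
  have h1 := integral_map (f := fun x => x * x) (h.measurable_noise k t).aemeasurable
    ((measurable_id.mul measurable_id).aestronglyMeasurable (μ := P.map (Z k t)))
  have h2 : Var[id; gaussianReal 0 (1 - α k ^ 2).toNNReal] = _ := variance_id_gaussianReal
  rw [variance_of_integral_eq_zero aemeasurable_id integral_id_gaussianReal,
    Real.coe_toNNReal _ (one_sub_sq_pos (hα k)).le] at h2
  rw [h.noise_law] at h1
  rw [← h1]
  simpa only [sq, id] using h2

theorem integral_noise_mul (h : IsMarkovianSignal P α θ Z X) (k k' : Fin 2) {s t : ℕ}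
    (hst : s ≠ t) : ∫ ω, Z k s ω * Z k' t ω ∂P = 0 := by
  have h1 := (h.noise_indep.indepFun hst).comp (measurable_pi_apply k) (measurable_pi_apply k')
  have h2 := h1.integral_fun_mul_eq_mul_integral (h.measurable_noise k s).aestronglyMeasurable
    (h.measurable_noise k' t).aestronglyMeasurable
  simp only [Function.comp_apply] at h2
  rw [h2]
  simp [h.integral_noise]

/-- On the path event the recursion has deterministic coefficients, and the noise, being independent
of the chain, keeps its moments. The restricted measure is not normalized, so its mass takes the
place of `1`. -/
theorem hasARMoments (h : IsMarkovianSignal P α θ Z X) (hα : ∀ k, |α k| < 1)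
    (hθ : ∀ t, Measurable (θ t)) (σ : ℕ → Fin 2) (M : ℕ) :
    HasARMoments (P.restrict {ω | ∀ i, i ≤ M → θ i ω = σ i}) α σ X M := by
  set B : Set (ℕ → Fin 2) := {x | ∀ i, i ≤ M → x i = σ i} with hB
  have hBm : MeasurableSet B := by
    have : B = ⋂ i, ⋂ (_ : i ≤ M), (fun x : ℕ → Fin 2 => x i) ⁻¹' {σ i} := by
      ext x; simp [hB]
    rw [this]
    exact MeasurableSet.iInter fun i => MeasurableSet.iInter fun _ =>
      measurable_pi_apply i (measurableSet_singleton _)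
  have hΘ : Measurable fun ω t => θ t ω := measurable_pi_lambda _ hθ
  have hA : {ω | ∀ i, i ≤ M → θ i ω = σ i} = (fun ω t => θ t ω) ⁻¹' B := rfl
  rw [hA]
  set A := (fun ω t => θ t ω) ⁻¹' B with hA'
  have hAm : MeasurableSet A := hΘ hBm
  have hZ : Measurable fun ω (k : Fin 2) t => Z k t ω :=
    measurable_pi_lambda _ fun k => measurable_pi_lambda _ fun t => h.measurable_noise k t
  have hZθ : IndepFun (fun ω (k : Fin 2) t => Z k t ω) (fun ω t => θ t ω) P :=
    h.noise_indep_rest.comp measurable_id measurable_snd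
  have hq : (P.restrict A).real Set.univ = P.real A := by
    simp [measureReal_def]
  have hZZ : ∀ k s k' t, ∫ ω in A, Z k s ω * Z k' t ω ∂P =
      P.real A * ∫ ω, Z k s ω * Z k' t ω ∂P := fun k s k' t =>
    hZθ.setIntegral_preimage hZ hΘ (φ := fun z => z k s * z k' t) (by fun_prop) hBm
  -- This needs independence of the noise from the pair (initial value, chain), since the integrand
  -- involves `X 0` and the indicator of the path event together.
  have hXZ0 : ∀ k t, ∫ ω in A, X 0 ω * Z k t ω ∂P = 0 := by
    intro k t
    have h1 := h.noise_indep_rest.integral_fun_comp_mul_comp (f := fun z => z k t)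
      (g := fun y => y.1 * B.indicator (fun _ => (1 : ℝ)) y.2)
      hZ.aemeasurable (h.measurable_init.prodMk hΘ).aemeasurable
      (by fun_prop : Measurable fun z : Fin 2 → ℕ → ℝ => z k t).aestronglyMeasurable
      (measurable_fst.mul ((measurable_const.indicator hBm).comp
        measurable_snd)).aestronglyMeasurable
    rw [h.integral_noise, zero_mul] at h1
    rw [← h1, ← integral_indicator hAm]
    congr 1
    ext ω
    by_cases hω : ω ∈ A
    · have hω' : (fun t => θ t ω) ∈ B := hω
      simp [hω, hω', mul_comm]
    · have hω' : (fun t => θ t ω) ∉ B := hω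
      simp [hω, hω']
  have hrec : ∀ t, t < M → X (t + 1) =ᵐ[P.restrict A]
      fun ω => α (σ t) * X t ω + Z (σ t) (t + 1) ω := by
    intro t ht
    filter_upwards [ae_restrict_mem hAm] with ω hω
    rw [h.recursion, show θ t ω = σ t from hω t ht.le]
  have hZL : ∀ k t, MemLp (Z k t) 2 (P.restrict A) := fun k t => (h.memLp_noise k t).restrict A
  have hmem : ∀ t, t ≤ M → MemLp (X t) 2 (P.restrict A) := by
    intro t
    induction t with
    | zero => exact fun _ => h.memLp_init.restrict A
    | succ t ih =>
      intro ht
      exact (memLp_congr_ae (hrec t ht)).2 (((ih (by omega)).const_mul _).add (hZL _ _))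
  have hmulint : ∀ {f g : Ω → ℝ}, MemLp f 2 (P.restrict A) → MemLp g 2 (P.restrict A) →
      Integrable (fun ω => f ω * g ω) (P.restrict A) := fun hf hg => hf.integrable_mul hg
  -- The signal is uncorrelated with later noise; this removes the cross terms from both moment
  -- recursions.
  have hXZ : ∀ b, b ≤ M → ∀ k t, b < t → ∫ ω in A, X b ω * Z k t ω ∂P = 0 := by
    intro b
    induction b with
    | zero => exact fun _ k t _ => hXZ0 k t
    | succ b ih =>
      intro hb k t hbt
      have h1 : ∫ ω in A, X (b + 1) ω * Z k t ω ∂P =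
          ∫ ω in A, α (σ b) * (X b ω * Z k t ω) + Z (σ b) (b + 1) ω * Z k t ω ∂P := by
        refine integral_congr_ae ?_
        filter_upwards [hrec b hb] with ω hω
        rw [hω]; ring
      rw [h1, integral_add ((hmulint (hmem b (by omega)) (hZL k t)).const_mul _)
        (hmulint (hZL _ _) (hZL k t)), integral_const_mul, ih (by omega) k t (by omega), hZZ,
        h.integral_noise_mul _ _ (by omega)]
      simp
  refine ⟨hmem, ?_, ?_⟩
  · intro t
    rw [hq]
    induction t with
    | zero =>
      intro _
      have h1 := h.init_indep_chain.setIntegral_preimage h.measurable_init hΘ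
        (φ := fun x => x ^ 2) (by fun_prop) hBm
      rw [h.power_init, mul_one] at h1
      simpa only [sq] using h1
    -- The power is preserved since `α² + (1 - α²) = 1` for either state.
    | succ t ih =>
      intro ht
      have h1 : ∫ ω in A, X (t + 1) ω * X (t + 1) ω ∂P =
          ∫ ω in A, (α (σ t) ^ 2 * (X t ω * X t ω) + 2 * α (σ t) * (X t ω * Z (σ t) (t + 1) ω))
            + Z (σ t) (t + 1) ω * Z (σ t) (t + 1) ω ∂P := by
        refine integral_congr_ae ?_
        filter_upwards [hrec t ht] with ω hω
        rw [hω]; ring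
      have i1 := hmulint (hmem t (by omega)) (hmem t (by omega))
      have i2 := hmulint (hmem t (by omega)) (hZL (σ t) (t + 1))
      have i3 : Integrable (fun ω => α (σ t) ^ 2 * (X t ω * X t ω) +
          2 * α (σ t) * (X t ω * Z (σ t) (t + 1) ω)) (P.restrict A) :=
        (i1.const_mul _).add (i2.const_mul _)
      rw [h1, integral_add i3 (hmulint (hZL _ _) (hZL _ _)),
        integral_add (i1.const_mul _) (i2.const_mul _), integral_const_mul, integral_const_mul,
        ih (by omega), hXZ t (by omega) _ _ (by omega), hZZ, h.integral_noise_sq hα]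
      ring
  · intro b c hbc hc
    have h1 : ∫ ω in A, X b ω * X (c + 1) ω ∂P =
        ∫ ω in A, α (σ c) * (X b ω * X c ω) + X b ω * Z (σ c) (c + 1) ω ∂P := by
      refine integral_congr_ae ?_
      filter_upwards [hrec c hc] with ω hω
      rw [hω]; ring
    rw [h1, integral_add ((hmulint (hmem b (by omega)) (hmem c (by omega))).const_mul _)
      (hmulint (hmem b (by omega)) (hZL _ _)), integral_const_mul,
      hXZ b (by omega) _ _ (by omega), add_zero]

end IsMarkovianSignal

end signal

namespace HasARMoments

variable {Ω : Type u} [MeasurableSpace Ω] {Q : Measure Ω}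
  {α : Fin 2 → ℝ} {σ : ℕ → Fin 2} {X : ℕ → Ω → ℝ} {M : ℕ}

theorem integrable_mul (h : HasARMoments Q α σ X M) {a b : ℕ} (ha : a ≤ M) (hb : b ≤ M) :
    Integrable (fun ω => X a ω * X b ω) Q := (h.memLp a ha).integrable_mul (h.memLp b hb)

/-- Only the coefficients between `a` and `b` enter; what the chain does before `a` is irrelevant.
-/
theorem corr_of_const (h : HasARMoments Q α σ X M) {k : Fin 2} {a b c : ℕ} (hca : c ≤ a)
    (hab : a ≤ b) (hb : b ≤ M) (hk : ∀ v, a ≤ v → v < b → σ v = k) :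
    ∫ ω, X c ω * X b ω ∂Q = α k ^ (b - a) * ∫ ω, X c ω * X a ω ∂Q := by
  induction b, hab using Nat.le_induction with
  | base => simp
  | succ b hab ih =>
    rw [h.corr_succ c b (by omega) (by omega), hk b hab (by omega),
      ih (by omega) fun v h1 h2 => hk v h1 (by omega), Nat.succ_sub hab, pow_succ]
    ring

theorem corr_eq_arAutocorr (h : HasARMoments Q α σ X M) {k : Fin 2} {a b lo hi : ℕ}
    (ha : lo ≤ a) (hb : lo ≤ b) (ha' : a ≤ hi) (hb' : b ≤ hi) (hM : hi ≤ M)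
    (hk : ∀ v, lo ≤ v → v < hi → σ v = k) :
    ∫ ω, X a ω * X b ω ∂Q = arAutocorr (α k) ((a : ℤ) - b) * Q.real Set.univ := by
  wlog hab : a ≤ b generalizing a b
  · rw [arAutocorr, ← Int.natAbs_neg, neg_sub]
    simp_rw [mul_comm (X a _)]
    exact this hb ha hb' ha' (by omega)
  rw [h.corr_of_const le_rfl hab (by omega) fun v h1 h2 => hk v (by omega) (by omega),
    h.power a (by omega), arAutocorr]
  congr 3
  omega

/-! ### Mean square error of linear prediction -/

section prediction

variable {m : ℕ} {s : Fin m → ℕ} {n : ℕ}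

theorem integrable_sq_error (h : HasARMoments Q α σ X M) (hn : n ≤ M) (hs : ∀ j, s j ≤ M)
    (v : Fin m → ℝ) : Integrable (fun ω => (X n ω - ∑ j, v j * X (s j) ω) ^ 2) Q :=
  ((h.memLp n hn).sub (memLp_finsetSum _ fun j _ => (h.memLp (s j) (hs j)).const_mul (v j))
    ).integrable_sq

/-- From `(x - y)² ≤ 2x² + 2y²` and Cauchy–Schwarz. Nothing is asked of the path, so the bound
serves at disturbed times. -/
theorem integral_sq_error_le (h : HasARMoments Q α σ X M) (hn : n ≤ M) (hs : ∀ j, s j ≤ M)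
    {v : Fin m → ℝ} {b : ℝ} (hv : ∀ j, |v j| ≤ b) :
    ∫ ω, (X n ω - ∑ j, v j * X (s j) ω) ^ 2 ∂Q ≤ 2 * (1 + m ^ 2 * b ^ 2) * Q.real Set.univ := by
  have hpt : ∀ ω, (X n ω - ∑ j, v j * X (s j) ω) ^ 2 ≤
      2 * (X n ω * X n ω) + ∑ j, 2 * m * b ^ 2 * (X (s j) ω * X (s j) ω) := by
    intro ω
    have h1 : (∑ j, v j * X (s j) ω) ^ 2 ≤ m * ∑ j, (v j * X (s j) ω) ^ 2 := by
      simpa using sq_sum_le_card_mul_sum_sq (s := Finset.univ) (f := fun j => v j * X (s j) ω)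
    have h2 : ∑ j, (v j * X (s j) ω) ^ 2 ≤ ∑ j, b ^ 2 * (X (s j) ω * X (s j) ω) := by
      refine Finset.sum_le_sum fun j _ => ?_
      rw [mul_pow, sq (X (s j) ω)]
      have : v j ^ 2 ≤ b ^ 2 := sq_le_sq' (abs_le.1 (hv j)).1 (abs_le.1 (hv j)).2
      have h3 := mul_self_nonneg (X (s j) ω)
      gcongr
    have h3 : ∑ j, 2 * m * b ^ 2 * (X (s j) ω * X (s j) ω) =
        2 * (m * ∑ j, b ^ 2 * (X (s j) ω * X (s j) ω)) := by
      rw [Finset.mul_sum, Finset.mul_sum]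
      exact Finset.sum_congr rfl fun j _ => by ring
    have h4 := mul_le_mul_of_nonneg_left h2 (Nat.cast_nonneg (α := ℝ) m)
    rw [h3]
    nlinarith [sq_nonneg (X n ω + ∑ j, v j * X (s j) ω)]
  have i1 : ∀ j ∈ Finset.univ, Integrable
      (fun ω => 2 * (m : ℝ) * b ^ 2 * (X (s j) ω * X (s j) ω)) Q := fun j _ =>
    (h.integrable_mul (hs j) (hs j)).const_mul _
  have i2 := (h.integrable_mul hn hn).const_mul 2
  refine (integral_mono (h.integrable_sq_error hn hs v) (i2.add (integrable_finsetSum _ i1))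
    hpt).trans (le_of_eq ?_)
  simp only [Pi.add_apply]
  rw [integral_add i2 (integrable_finsetSum _ i1), integral_finsetSum _ i1,
    integral_const_mul, h.power n hn]
  simp_rw [integral_const_mul, fun j => h.power (s j) (hs j)]
  simp
  ring

theorem integral_sq_error_eq (h : HasARMoments Q α σ X M) (hn : n ≤ M) (hs : ∀ j, s j ≤ M)
    (v : Fin m → ℝ) :
    ∫ ω, (X n ω - ∑ j, v j * X (s j) ω) ^ 2 ∂Q =
      ∫ ω, X n ω * X n ω ∂Q - 2 * ∑ j, v j * ∫ ω, X n ω * X (s j) ω ∂Q +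
        ∑ i, ∑ j, v i * v j * ∫ ω, X (s i) ω * X (s j) ω ∂Q := by
  have hpt : ∀ ω, (X n ω - ∑ j, v j * X (s j) ω) ^ 2 =
      X n ω * X n ω - 2 * ∑ j, v j * (X n ω * X (s j) ω) +
        ∑ i, ∑ j, v i * v j * (X (s i) ω * X (s j) ω) := by
    intro ω
    have h1 : ∑ j, v j * (X n ω * X (s j) ω) = X n ω * ∑ j, v j * X (s j) ω := by
      rw [Finset.mul_sum]
      exact Finset.sum_congr rfl fun j _ => by ring
    have h2 : ∑ i, ∑ j, v i * v j * (X (s i) ω * X (s j) ω) =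
        (∑ j, v j * X (s j) ω) * ∑ j, v j * X (s j) ω := by
      rw [Finset.sum_mul_sum]
      exact Finset.sum_congr rfl fun i _ => Finset.sum_congr rfl fun j _ => by ring
    rw [h1, h2]
    ring
  have i1 : ∀ j ∈ Finset.univ, Integrable (fun ω => v j * (X n ω * X (s j) ω)) Q := fun j _ =>
    (h.integrable_mul hn (hs j)).const_mul _
  have i2 : ∀ i, ∀ j ∈ Finset.univ, Integrable
      (fun ω => v i * v j * (X (s i) ω * X (s j) ω)) Q := fun i j _ =>
    (h.integrable_mul (hs i) (hs j)).const_mul _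
  have i3 := (integrable_finsetSum _ i1).const_mul 2
  have i4 : ∀ i ∈ Finset.univ, Integrable
      (fun ω => ∑ j, v i * v j * (X (s i) ω * X (s j) ω)) Q := fun i _ =>
    integrable_finsetSum _ (i2 i)
  have i5 : Integrable (fun ω => X n ω * X n ω - 2 * ∑ j, v j * (X n ω * X (s j) ω)) Q :=
    (h.integrable_mul hn hn).sub i3
  simp_rw [hpt]
  rw [integral_add i5 (integrable_finsetSum _ i4),
    integral_sub (h.integrable_mul hn hn) i3, integral_const_mul, integral_finsetSum _ i1,
    integral_finsetSum _ i4]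
  simp_rw [fun i => integral_finsetSum _ (i2 i), integral_const_mul]

/-- The optimal weights need not be those of the one-sample predictor, so two inequalities are
shown. Minimality gives `≤` by comparison with weight `α^(n - a)` on the latest sample. For `≥`, the
innovation `X n - α^(n - a) * X a` is orthogonal to every `X b` with `b ≤ a`, so no linear predictor
does better. -/
theorem integral_sq_error_of_const (h : HasARMoments Q α σ X M) (hn : n ≤ M) {a lo : ℕ}
    (hs : ∀ j, s j ≤ a) (hlo : ∀ j, lo ≤ s j) (j₀ : Fin m) (hj₀ : s j₀ = a) (han : a ≤ n)
    {k : Fin 2} (hk : ∀ v, lo ≤ v → v < n → σ v = k) {v : Fin m → ℝ}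
    (hv : ∀ v', predErrorPower (arAutocorr (α k)) (fun j => n - s j) v ≤
      predErrorPower (arAutocorr (α k)) (fun j => n - s j) v') :
    ∫ ω, (X n ω - ∑ j, v j * X (s j) ω) ^ 2 ∂Q =
      (1 - α k ^ (2 * (n - a))) * Q.real Set.univ := by
  have hla : lo ≤ a := hj₀ ▸ hlo j₀
  have hsn : ∀ j, s j ≤ n := fun j => (hs j).trans han
  have hsM : ∀ j, s j ≤ M := fun j => (hsn j).trans hn
  apply le_antisymm
  · have h1 : ∫ ω, (X n ω - ∑ j, v j * X (s j) ω) ^ 2 ∂Q =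
        predErrorPower (arAutocorr (α k)) (fun j => n - s j) v * Q.real Set.univ := by
      have hc : ∀ j, ∫ ω, X n ω * X (s j) ω ∂Q =
          arAutocorr (α k) ((n - s j : ℕ) : ℤ) * Q.real Set.univ := fun j => by
        rw [h.corr_eq_arAutocorr (by omega) (hlo j) le_rfl (hsn j) hn hk, Nat.cast_sub (hsn j)]
      have hd : ∀ i j, ∫ ω, X (s i) ω * X (s j) ω ∂Q = arAutocorr (α k)
          (((n - s i : ℕ) : ℤ) - ((n - s j : ℕ) : ℤ)) * Q.real Set.univ := fun i j => by
        rw [h.corr_eq_arAutocorr (hlo i) (hlo j) (hsn i) (hsn j) hn hk, Nat.cast_sub (hsn i),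
          Nat.cast_sub (hsn j), arAutocorr, ← Int.natAbs_neg, arAutocorr]
        congr 3
        ring
      rw [h.integral_sq_error_eq hn hsM, h.power n hn, predErrorPower]
      simp_rw [hc, hd, add_mul, sub_mul, Finset.mul_sum, Finset.sum_mul]
      congr 1
      · congr 1
        · simp [arAutocorr]
        · exact Finset.sum_congr rfl fun j _ => by ring
      · exact Finset.sum_congr rfl fun i _ => Finset.sum_congr rfl fun j _ => by ring
    rw [h1]
    refine mul_le_mul_of_nonneg_right
      ((hv (Pi.single j₀ (α k ^ (n - a)))).trans (le_of_eq ?_)) measureReal_nonneg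
    have e1 : ∀ f : Fin m → ℝ, ∑ j, (Pi.single j₀ (α k ^ (n - a)) : Fin m → ℝ) j * f j =
        α k ^ (n - a) * f j₀ := fun f => by
      simp [Pi.single_apply, ite_mul]
    simp only [predErrorPower, mul_assoc, ← Finset.mul_sum]
    rw [e1, e1, e1]
    simp only [arAutocorr, hj₀, sub_self, Int.natAbs_zero, pow_zero, Int.natAbs_natCast, mul_one]
    ring
  · set c := α k ^ (n - a) with hc
    have haM : a ≤ M := han.trans hn
    have hka : ∀ v, a ≤ v → v < n → σ v = k := fun v h1 h2 => hk v (by omega) h2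
    have horth : ∀ b, b ≤ a → ∫ ω, (X n ω - c * X a ω) * X b ω ∂Q = 0 := by
      intro b hb
      have e : ∀ ω, (X n ω - c * X a ω) * X b ω = X b ω * X n ω - c * (X b ω * X a ω) :=
        fun ω => by ring
      simp_rw [e]
      rw [integral_sub (h.integrable_mul (by omega) hn)
        ((h.integrable_mul (by omega) haM).const_mul _), integral_const_mul,
        h.corr_of_const hb han hn hka, sub_self]
    have hWL : MemLp (fun ω => X n ω - c * X a ω) 2 Q :=
      (h.memLp n hn).sub ((h.memLp a haM).const_mul c)
    have iWX : ∀ b, b ≤ M → Integrable (fun ω => (X n ω - c * X a ω) * X b ω) Q :=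
      fun b hb => hWL.integrable_mul (h.memLp b hb)
    have iS : ∀ j ∈ Finset.univ,
        Integrable (fun ω => v j * ((X n ω - c * X a ω) * X (s j) ω)) Q :=
      fun j _ => (iWX _ (hsM j)).const_mul _
    have i1 := iWX n hn
    have i2 := (iWX a haM).const_mul c
    have i3 := (integrable_finsetSum _ iS).const_mul 2
    have i4 : Integrable (fun ω => (X n ω - c * X a ω) * X n ω +
        c * ((X n ω - c * X a ω) * X a ω)) Q := i1.add i2
    have hW : ∫ ω, (X n ω - c * X a ω) * X n ω ∂Q =
        (1 - α k ^ (2 * (n - a))) * Q.real Set.univ := by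
      have e : ∀ ω, (X n ω - c * X a ω) * X n ω = X n ω * X n ω - c * (X a ω * X n ω) :=
        fun ω => by ring
      simp_rw [e]
      rw [integral_sub (h.integrable_mul hn hn) ((h.integrable_mul haM hn).const_mul _),
        integral_const_mul, h.corr_of_const le_rfl han hn hka, h.power n hn, h.power a haM, hc]
      ring
    -- With `W` the innovation and `V` the predictor, the integrand is `W² + 2W(c X_a - V)`, that
    -- is, the squared error minus `(c X_a - V)²`.
    have hlow : ∫ ω, ((X n ω - c * X a ω) * X n ω + c * ((X n ω - c * X a ω) * X a ω))
        - 2 * ∑ j, v j * ((X n ω - c * X a ω) * X (s j) ω) ∂Q =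
        (1 - α k ^ (2 * (n - a))) * Q.real Set.univ := by
      rw [integral_sub i4 i3, integral_add i1 i2, integral_const_mul, integral_const_mul,
        integral_finsetSum _ iS, hW, horth a le_rfl]
      simp_rw [integral_const_mul, fun j => horth (s j) (hs j)]
      simp
    rw [← hlow]
    refine integral_mono (i4.sub i3) (h.integrable_sq_error hn hsM v) fun ω => ?_
    have e : ∑ j, v j * ((X n ω - c * X a ω) * X (s j) ω) =
        (X n ω - c * X a ω) * ∑ j, v j * X (s j) ω := by
      rw [Finset.mul_sum]
      exact Finset.sum_congr rfl fun j _ => by ring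
    simp only [e]
    nlinarith [sq_nonneg (c * X a ω - ∑ j, v j * X (s j) ω)]

end prediction

end HasARMoments

/-! ### The chain -/

/-- The path that agrees with `x` until time `n` and stays at `0` afterwards. -/
def extendPath {n : ℕ} (x : Fin (n + 1) → Fin 2) (i : ℕ) : Fin 2 :=
  if h : i < n + 1 then x ⟨i, h⟩ else 0

/-- The event that the chain follows the path `s` until time `n`. -/
def pathEvent {Ω : Type u} (θ : ℕ → Ω → Fin 2) (n : ℕ) (s : ℕ → Fin 2) : Set Ω :=
  {ω | ∀ i, i ≤ n → θ i ω = s i}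

/-- The two states of the chain as signs. -/
def stateSign (k : Fin 2) : ℝ := if k = 0 then 1 else -1

theorem stateSign_mul_self (k : Fin 2) : stateSign k * stateSign k = 1 := by
  unfold stateSign; split_ifs <;> norm_num

theorem stateSign_eq (j k : Fin 2) :
    stateSign j = stateSign k * (2 * (if j = k then 1 else 0) - 1) := by
  unfold stateSign
  fin_cases j <;> fin_cases k <;> norm_num

/-- Reduces time averages of any function of the state to sums of signs. -/
theorem eq_average_add_stateSign (r : Fin 2 → ℝ) (k : Fin 2) :
    r k = (r 0 / 2 + r 1 / 2) + (r 0 - r 1) / 2 * stateSign k := by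
  unfold stateSign
  fin_cases k <;> simp <;> ring

theorem iUnion_pathEvent {Ω : Type u} (θ : ℕ → Ω → Fin 2) (n : ℕ) :
    ⋃ x : Fin (n + 1) → Fin 2, pathEvent θ n (extendPath x) = Set.univ := by
  refine Set.eq_univ_of_forall fun ω => Set.mem_iUnion.2 ⟨fun i => θ i ω, fun i hi => ?_⟩
  rw [extendPath, dif_pos (by omega)]

theorem pairwise_disjoint_pathEvent {Ω : Type u} (θ : ℕ → Ω → Fin 2) (n : ℕ) :
    Pairwise (Function.onFun Disjoint
      fun x : Fin (n + 1) → Fin 2 => pathEvent θ n (extendPath x)) := by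
  intro x y hxy
  refine Set.disjoint_left.2 fun ω hx hy => hxy (funext fun i => ?_)
  have h1 := hx i (by omega)
  have h2 := hy i (by omega)
  rw [extendPath, dif_pos i.2] at h1 h2
  exact h1.symm.trans h2

section

variable {Ω : Type u} [MeasurableSpace Ω] {P : Measure Ω} {θ : ℕ → Ω → Fin 2}

theorem measurableSet_pathEvent (hθ : ∀ t, Measurable (θ t)) (n : ℕ) (s : ℕ → Fin 2) :
    MeasurableSet (pathEvent θ n s) := by
  have : pathEvent θ n s = ⋂ i, ⋂ (_ : i ≤ n), θ i ⁻¹' {s i} := by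
    ext ω; simp [pathEvent]
  rw [this]
  exact MeasurableSet.iInter fun i => MeasurableSet.iInter fun _ =>
    hθ i (measurableSet_singleton _)

theorem integral_eq_sum_pathEvent (hθ : ∀ t, Measurable (θ t)) (n : ℕ) {f : Ω → ℝ}
    (hf : ∀ x : Fin (n + 1) → Fin 2, IntegrableOn f (pathEvent θ n (extendPath x)) P) :
    ∫ ω, f ω ∂P = ∑ x : Fin (n + 1) → Fin 2, ∫ ω in pathEvent θ n (extendPath x), f ω ∂P := by
  rw [← integral_iUnion_fintype (fun x => measurableSet_pathEvent hθ n _)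
    (pairwise_disjoint_pathEvent θ n) hf, iUnion_pathEvent, Measure.restrict_univ]

theorem integrable_of_pathEvent (n : ℕ) {f : Ω → ℝ}
    (hf : ∀ x : Fin (n + 1) → Fin 2, IntegrableOn f (pathEvent θ n (extendPath x)) P) :
    Integrable f P := by
  rw [← integrableOn_univ, ← iUnion_pathEvent θ n]
  exact integrableOn_finite_iUnion.2 hf

variable [IsProbabilityMeasure P] {p : ℝ}

/-- A function of finitely many chain values is constant on each of finitely many path events. -/
theorem integrable_comp_path (hθ : ∀ t, Measurable (θ t)) (s : Finset ℕ) (F : (ℕ → Fin 2) → ℝ)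
    (hF : ∀ x y, (∀ i ∈ s, x i = y i) → F x = F y) : Integrable (fun ω => F fun t => θ t ω) P := by
  refine integrable_of_pathEvent (θ := θ) (s.sup id) fun x => ?_
  have h : Set.EqOn (fun ω => F fun t => θ t ω) (fun _ => F (extendPath x))
      (pathEvent θ (s.sup id) (extendPath x)) := fun ω hω =>
    hF _ _ fun i hi => hω i (Finset.le_sup (f := id) hi)
  exact (integrableOn_congr_fun h (measurableSet_pathEvent hθ _ _)).2 (integrable_const _)

namespace IsSymmetricChain

theorem integrable_sign_mul (h : IsSymmetricChain P p θ) (u v : ℕ) :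
    Integrable (fun ω => stateSign (θ u ω) * stateSign (θ v ω)) P :=
  integrable_comp_path h.measurable {u, v} (fun x => stateSign (x u) * stateSign (x v))
    fun x y hxy => by rw [hxy u (by simp), hxy v (by simp)]

/-- The path prolonged by staying put turns the transition rule into the conditional probability `1
- p`; the next sign then has conditional mean `(1 - 2p)` times the current one. -/
theorem setIntegral_sign_succ (h : IsSymmetricChain P p θ) (n : ℕ) (s : ℕ → Fin 2) :
    ∫ ω in pathEvent θ n s, stateSign (θ (n + 1) ω) ∂P =
      (1 - 2 * p) * (stateSign (s n) * P.real (pathEvent θ n s)) := by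
  have hm := measurableSet_pathEvent h.measurable n s
  set s' : ℕ → Fin 2 := Function.update s (n + 1) (s n) with hs'
  have hs1 : ∀ i, i ≤ n → s' i = s i := fun i hi => Function.update_of_ne (by omega) _ _
  have hs2 : s' (n + 1) = s n := Function.update_self _ _ _
  have htr := h.transition n s'
  rw [hs2, hs1 n le_rfl, if_pos rfl] at htr
  have e1 : {ω | ∀ i, i ≤ n → θ i ω = s' i} = pathEvent θ n s := by
    ext ω
    exact forall₂_congr fun i hi => by rw [hs1 i hi]
  have e2 : {ω | ∀ i, i ≤ n + 1 → θ i ω = s' i} =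
      θ (n + 1) ⁻¹' {s n} ∩ pathEvent θ n s := by
    ext ω
    constructor
    · intro hω
      exact ⟨(hω (n + 1) le_rfl).trans hs2, fun i hi => (hω i (by omega)).trans (hs1 i hi)⟩
    · rintro ⟨h1, h2⟩ i hi
      rcases Nat.lt_or_eq_of_le hi with hi | rfl
      · exact (h2 i (by omega)).trans (hs1 i (by omega)).symm
      · exact Eq.trans h1 hs2.symm
  rw [e1, e2] at htr
  have hm' : MeasurableSet (θ (n + 1) ⁻¹' {s n}) := h.measurable _ (measurableSet_singleton _)
  have e3 : ∀ ω, stateSign (θ (n + 1) ω) =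
      stateSign (s n) * (2 * (θ (n + 1) ⁻¹' {s n}).indicator 1 ω - 1) := fun ω => by
    rw [stateSign_eq _ (s n)]
    by_cases hω : θ (n + 1) ω = s n <;> simp [Set.indicator, hω]
  simp_rw [e3]
  rw [integral_const_mul, integral_sub (((integrable_const 1).indicator hm').const_mul 2)
    (integrable_const 1), integral_const_mul, integral_indicator_one hm',
    measureReal_restrict_apply hm', htr]
  simp
  ring

theorem integral_sign_mul_succ (h : IsSymmetricChain P p θ) {u n : ℕ} (hu : u ≤ n) :
    ∫ ω, stateSign (θ u ω) * stateSign (θ (n + 1) ω) ∂P =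
      (1 - 2 * p) * ∫ ω, stateSign (θ u ω) * stateSign (θ n ω) ∂P := by
  rw [integral_eq_sum_pathEvent h.measurable n fun x => (h.integrable_sign_mul _ _).integrableOn,
    integral_eq_sum_pathEvent h.measurable n fun x => (h.integrable_sign_mul _ _).integrableOn,
    Finset.mul_sum]
  refine Finset.sum_congr rfl fun x _ => ?_
  set s := extendPath x
  have hm := measurableSet_pathEvent h.measurable n s
  have e1 : ∫ ω in pathEvent θ n s, stateSign (θ u ω) * stateSign (θ (n + 1) ω) ∂P =
      ∫ ω in pathEvent θ n s, stateSign (s u) * stateSign (θ (n + 1) ω) ∂P :=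
    setIntegral_congr_fun hm fun ω hω => by simp only [hω u hu]
  have e2 : ∫ ω in pathEvent θ n s, stateSign (θ u ω) * stateSign (θ n ω) ∂P =
      ∫ ω in pathEvent θ n s, stateSign (s u) * stateSign (s n) ∂P :=
    setIntegral_congr_fun hm fun ω hω => by simp only [hω u hu, hω n le_rfl]
  rw [e1, e2, integral_const_mul, h.setIntegral_sign_succ, setIntegral_const]
  simp only [smul_eq_mul]
  ring

theorem integral_sum_sign_mul_succ (h : IsSymmetricChain P p θ) (n : ℕ) :
    ∫ ω, (∑ u ∈ Finset.range (n + 1), stateSign (θ u ω)) * stateSign (θ (n + 1) ω) ∂P =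
      (1 - 2 * p) * (∫ ω, (∑ u ∈ Finset.range n, stateSign (θ u ω)) * stateSign (θ n ω) ∂P + 1) := by
  simp_rw [Finset.sum_mul]
  rw [integral_finsetSum _ fun u _ => h.integrable_sign_mul u _,
    integral_finsetSum _ fun u _ => h.integrable_sign_mul u _,
    Finset.sum_congr rfl fun u hu =>
      h.integral_sign_mul_succ (Nat.lt_succ_iff.1 (Finset.mem_range.1 hu)),
    ← Finset.mul_sum, Finset.sum_range_succ]
  simp [stateSign_mul_self]

/-- The quantity obeys `a (n + 1) = (1 - 2p)(a n + 1)` with `a 0 = 0`. For `2p ≤ 1` the map is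
increasing and preserves `[-1, 1/(2p)]`; for `2p ≥ 1` it is decreasing and preserves `[-1, 0]`. -/
theorem integral_sum_sign_mul_mem (h : IsSymmetricChain P p θ) (hp : 0 < p) (hp1 : p ≤ 1) (n : ℕ) :
    -1 ≤ ∫ ω, (∑ u ∈ Finset.range n, stateSign (θ u ω)) * stateSign (θ n ω) ∂P ∧
      2 * p * ∫ ω, (∑ u ∈ Finset.range n, stateSign (θ u ω)) * stateSign (θ n ω) ∂P ≤ 1 := by
  have key : ∀ a : ℕ → ℝ, a 0 = 0 → (∀ n, a (n + 1) = (1 - 2 * p) * (a n + 1)) →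
      ∀ n, -1 ≤ a n ∧ 2 * p * a n ≤ 1 := by
    intro a h0 hs n
    rcases le_total (2 * p) 1 with hq | hq
    · induction n with
      | zero => rw [h0]; constructor <;> norm_num
      | succ n ih =>
        rw [hs]
        constructor <;> nlinarith [ih.1, ih.2]
    · have : -1 ≤ a n ∧ a n ≤ 0 := by
        induction n with
        | zero => rw [h0]; constructor <;> norm_num
        | succ n ih =>
          rw [hs]
          constructor <;> nlinarith [ih.1, ih.2]
      exact ⟨this.1, by nlinarith⟩
  exact key (fun n => ∫ ω, (∑ u ∈ Finset.range n, stateSign (θ u ω)) * stateSign (θ n ω) ∂P)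
    (by simp) h.integral_sum_sign_mul_succ n

theorem integrable_sum_sign_sq (h : IsSymmetricChain P p θ) (n : ℕ) :
    Integrable (fun ω => (∑ u ∈ Finset.range n, stateSign (θ u ω)) ^ 2) P :=
  integrable_comp_path h.measurable (Finset.range n)
    (fun x => (∑ u ∈ Finset.range n, stateSign (x u)) ^ 2) fun x y hxy => by
      rw [Finset.sum_congr rfl fun u hu => by rw [hxy u hu]]

/-- Adding a sign raises the second moment by `2a + 1`, where `2a ≤ 1/p` by the previous bound. -/
theorem integral_sum_sign_sq_le (h : IsSymmetricChain P p θ) (hp : 0 < p) (hp1 : p ≤ 1) (n : ℕ) :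
    ∫ ω, (∑ u ∈ Finset.range n, stateSign (θ u ω)) ^ 2 ∂P ≤ n * (1 + 1 / p) := by
  induction n with
  | zero => simp
  | succ n ih =>
    have e : ∀ ω, (∑ u ∈ Finset.range (n + 1), stateSign (θ u ω)) ^ 2 =
        (∑ u ∈ Finset.range n, stateSign (θ u ω)) ^ 2 +
          (2 * ((∑ u ∈ Finset.range n, stateSign (θ u ω)) * stateSign (θ n ω)) + 1) := fun ω => by
      rw [Finset.sum_range_succ, ← stateSign_mul_self (θ n ω)]
      ring
    have i1 : Integrable
        (fun ω => (∑ u ∈ Finset.range n, stateSign (θ u ω)) * stateSign (θ n ω)) P := by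
      simp_rw [Finset.sum_mul]
      exact integrable_finsetSum _ fun u _ => h.integrable_sign_mul u n
    have i2 : Integrable (fun ω =>
        2 * ((∑ u ∈ Finset.range n, stateSign (θ u ω)) * stateSign (θ n ω)) + 1) P :=
      (i1.const_mul 2).add (integrable_const 1)
    simp_rw [e]
    rw [integral_add (h.integrable_sum_sign_sq n) i2,
      integral_add (i1.const_mul 2) (integrable_const 1), integral_const_mul]
    have h1 := (h.integral_sum_sign_mul_mem hp hp1 n).2
    set a := ∫ ω, (∑ u ∈ Finset.range n, stateSign (θ u ω)) * stateSign (θ n ω) ∂P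
    have h2 : 2 * a ≤ 1 / p := by
      rw [le_div_iff₀ hp]
      linarith
    push_cast
    simp
    simp at ih h2
    linarith

/-- Integrates `|x| ≤ c + x²/c` with `c = η * n`; the second term stays bounded in `n`. -/
theorem integral_abs_sum_sign_le (h : IsSymmetricChain P p θ) (hp : 0 < p) (hp1 : p ≤ 1) {η : ℝ}
    (hη : 0 < η) (n : ℕ) :
    ∫ ω, |∑ u ∈ Finset.range n, stateSign (θ u ω)| ∂P ≤ η * n + (1 + 1 / p) / η := by
  rcases Nat.eq_zero_or_pos n with rfl | hn
  · simp
    positivity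
  have hn' : (0 : ℝ) < n := by exact_mod_cast hn
  have hc : 0 < η * n := by positivity
  have hpt : ∀ x : ℝ, |x| ≤ η * n + x ^ 2 / (η * n) := fun x => by
    rw [← sq_abs]
    have h1 : 0 ≤ |x| := abs_nonneg x
    rcases le_total |x| (η * n) with h2 | h2
    · have : 0 ≤ |x| ^ 2 / (η * n) := by positivity
      linarith
    · have : |x| ≤ |x| ^ 2 / (η * n) := by
        rw [le_div_iff₀ hc]
        nlinarith
      linarith
  have i1 := (h.integrable_sum_sign_sq n).div_const (η * n)
  have i0 : Integrable (fun ω => |∑ u ∈ Finset.range n, stateSign (θ u ω)|) P :=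
    integrable_comp_path h.measurable (Finset.range n)
      (fun x => |∑ u ∈ Finset.range n, stateSign (x u)|) fun x y hxy => by
        rw [Finset.sum_congr rfl fun u hu => by rw [hxy u hu]]
  refine (integral_mono i0 ((integrable_const (η * n)).add i1) fun ω => hpt _).trans ?_
  simp only [Pi.add_apply]
  rw [integral_add (integrable_const _) i1, integral_div]
  have h2 := h.integral_sum_sign_sq_le hp hp1 n
  have h3 : (∫ ω, (∑ u ∈ Finset.range n, stateSign (θ u ω)) ^ 2 ∂P) / (η * n) ≤
      (1 + 1 / p) / η := by
    rw [div_le_div_iff₀ hc hη]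
    nlinarith
  simpa using h3

theorem integral_jump (h : IsSymmetricChain P p θ) (v : ℕ) :
    ∫ ω, (if θ v ω ≠ θ (v + 1) ω then (1 : ℝ) else 0) ∂P = p := by
  have e : ∀ ω, (if θ v ω ≠ θ (v + 1) ω then (1 : ℝ) else 0) =
      (1 - stateSign (θ v ω) * stateSign (θ (v + 1) ω)) / 2 := fun ω => by
    generalize θ v ω = a
    generalize θ (v + 1) ω = b
    fin_cases a <;> fin_cases b <;> norm_num [stateSign]
  simp_rw [e]
  rw [integral_div, integral_sub (integrable_const 1) (h.integrable_sign_mul _ _),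
    h.integral_sign_mul_succ le_rfl]
  simp [stateSign_mul_self]

open Classical in
theorem integrable_disturbed (h : IsSymmetricChain P p θ) (U L u : ℕ) :
    Integrable (fun ω => if IsDisturbed U L (fun t => θ t ω) u then (1 : ℝ) else 0) P := by
  refine integrable_comp_path h.measurable (Finset.range (u + L + 2))
    (fun x => if IsDisturbed U L x u then (1 : ℝ) else 0) fun x y hxy => ?_
  have : IsDisturbed U L x u ↔ IsDisturbed U L y u := by
    refine and_congr_right fun _ => exists_congr fun v => and_congr_right fun _ =>
      and_congr_right fun hv => ?_
    rw [hxy v (Finset.mem_range.2 (by omega)), hxy (v + 1) (Finset.mem_range.2 (by omega))]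
  simp only [this]

open Classical in
-- Union bound over at most `2L + 1` jump positions, each of probability `p`. For `U < 2` no time is
-- disturbed, so `p` need not be small.
theorem integral_disturbed_le (h : IsSymmetricChain P p θ) {U L : ℕ} {δ : ℝ} (hδ : 0 ≤ δ)
    (hp : 2 ≤ U → p ≤ δ) (u : ℕ) :
    ∫ ω, (if IsDisturbed U L (fun t => θ t ω) u then (1 : ℝ) else 0) ∂P ≤ (2 * L + 1) * δ := by
  by_cases hU : 2 ≤ U
  · have i1 : ∀ v ∈ Finset.Icc (u - L) (u + L),
        Integrable (fun ω => if θ v ω ≠ θ (v + 1) ω then (1 : ℝ) else 0) P := fun v _ =>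
      integrable_comp_path h.measurable {v, v + 1}
        (fun x => if x v ≠ x (v + 1) then (1 : ℝ) else 0) fun x y hxy => by
          rw [hxy v (by simp), hxy (v + 1) (by simp)]
    have hpt : ∀ ω, (if IsDisturbed U L (fun t => θ t ω) u then (1 : ℝ) else 0) ≤
        ∑ v ∈ Finset.Icc (u - L) (u + L), if θ v ω ≠ θ (v + 1) ω then (1 : ℝ) else 0 := by
      intro ω
      have hnn : ∀ v ∈ Finset.Icc (u - L) (u + L),
          0 ≤ if θ v ω ≠ θ (v + 1) ω then (1 : ℝ) else 0 := fun v _ => by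
        split_ifs <;> norm_num
      by_cases hd : IsDisturbed U L (fun t => θ t ω) u
      · obtain ⟨-, v, h1, h2, h3⟩ := hd
        have hd : IsDisturbed U L (fun t => θ t ω) u := ⟨hU, v, h1, h2, h3⟩
        rw [if_pos hd]
        have := Finset.single_le_sum hnn (Finset.mem_Icc.2 ⟨by omega, h2⟩ : v ∈ _)
        rwa [if_pos h3] at this
      · rw [if_neg hd]
        exact Finset.sum_nonneg hnn
    refine (integral_mono (h.integrable_disturbed U L u) (integrable_finsetSum _ i1) hpt).trans ?_
    rw [integral_finsetSum _ i1]
    simp_rw [h.integral_jump]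
    rw [Finset.sum_const, nsmul_eq_mul, Nat.card_Icc]
    have hc : ((u + L + 1 - (u - L) : ℕ) : ℝ) ≤ 2 * L + 1 := by
      have : u + L + 1 - (u - L) ≤ 2 * L + 1 := by omega
      exact_mod_cast this
    exact (mul_le_mul_of_nonneg_left (hp hU) (Nat.cast_nonneg _)).trans
      (mul_le_mul_of_nonneg_right hc hδ)
  · have : ∀ ω, ¬ IsDisturbed U L (fun t => θ t ω) u := fun ω hd => hU hd.1
    simp only [this, if_false, integral_zero]
    positivity

end IsSymmetricChain

end

/-! ### Rate and distortion along a run -/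

namespace IsGreedyRun

variable {m : ℕ} {T : Fin 3 → ℕ} {t₀ : Fin m → ℕ} {σ : ℕ → Fin 2} {κ : ℕ → Fin 3}
  {τ : ℕ → ℕ} {U : ℕ}

/-- If `U < 2`, the window may contain a jump, but an increment of length `1` leaves nothing to
predict; hence the alternative in the conclusion. -/
theorem increment_of_not_isDisturbed (h : IsGreedyRun T t₀ σ κ τ) (hm : 1 ≤ m) (hτ : StrictMono τ)
    (hT : ∀ k, 1 ≤ T k) (hU : ∀ k, T k ≤ U) {i : ℕ} (hi : 2 * m ≤ i)
    (hu : ∃ u, τ i ≤ u ∧ u < τ (i + 1) ∧ ¬ IsDisturbed U (m * U) σ u) :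
    ∃ k : Fin 2, τ (i + 1) = τ i + T k.castSucc ∧ (∀ v, τ i ≤ v → v < τ (i + 1) → σ v = k) ∧
      (T k.castSucc = 1 ∨ κ i = k.castSucc ∧
        ∀ v, τ (i + 1 - m) ≤ v → v < τ (i + 1) → σ v = k) := by
  obtain ⟨u, h1, h2, hu⟩ := hu
  rcases lt_or_ge U 2 with hU2 | hU2
  · have hT1 : ∀ k, T k = 1 := fun k => by
      have := hT k
      have := hU k
      omega
    have hs := h.step i (by omega)
    rw [hT1] at hs
    refine ⟨σ (τ i), by rw [hs, hT1], fun v hv1 hv2 => ?_, Or.inl (hT1 _)⟩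
    rw [show v = τ i by omega]
  · obtain ⟨k, hk, hs, hc⟩ := h.const_of_not_isDisturbed hm hτ hU hi h1 h2 hu hU2
    exact ⟨k, hs, fun v hv1 hv2 => hc v ((hτ.monotone (by omega)).trans hv1) hv2.le,
      Or.inr ⟨hk, fun v hv1 hv2 => hc v hv1 hv2.le⟩⟩

theorem time_le (h : IsGreedyRun T t₀ σ κ τ) (hm : 1 ≤ m) (hU : ∀ k, T k ≤ U) :
    τ (2 * m) ≤ t₀ ⟨m - 1, by omega⟩ + (m + 1) * U := by
  have h1 := h.time_add_le hU (i := m - 1) (by omega) (m + 1)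
  rw [show m - 1 + (m + 1) = 2 * m by omega] at h1
  have h2 := h.init ⟨m - 1, by omega⟩
  simp only at h2
  rwa [h2] at h1

theorem step_le (h : IsGreedyRun T t₀ σ κ τ) (hU : ∀ k, T k ≤ U) {i : ℕ} (hi : m ≤ i + 1) :
    τ (i + 1) ≤ τ i + U := by
  rw [h.step i hi]
  exact Nat.add_le_add_left (hU _) _

open Classical in
-- An undisturbed increment holds exactly one sample, and `1 / T_k` summed over its `T_k` times is
-- also `1`.
theorem abs_rate_sub_le (h : IsGreedyRun T t₀ σ κ τ) (hm : 1 ≤ m) (hτ : StrictMono τ)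
    (hT : ∀ k, 1 ≤ T k) (hU : ∀ k, T k ≤ U) (n : ℕ) :
    |∑ u ∈ Finset.range n, ((if ∃ j, τ j = u then 1 else 0) - 1 / (T (σ u).castSucc : ℝ))| ≤
      1 * (t₀ ⟨m - 1, by omega⟩ + (m + 1) * U : ℕ) +
        1 * (U + ∑ u ∈ Finset.range n, if IsDisturbed U (m * U) σ u then 1 else 0) := by
  have hb : ∀ u, |(if ∃ j, τ j = u then (1 : ℝ) else 0) - 1 / (T (σ u).castSucc : ℝ)| ≤ 1 := by
    intro u
    have h1 : (1 : ℝ) ≤ T (σ u).castSucc := by exact_mod_cast hT _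
    have h2 : 1 / (T (σ u).castSucc : ℝ) ≤ 1 := by rw [div_le_one (by positivity)]; exact h1
    have h3 : 0 ≤ 1 / (T (σ u).castSucc : ℝ) := by positivity
    rw [abs_le]
    split_ifs <;> constructor <;> linarith
  refine abs_sum_range_le zero_le_one zero_le_one hτ (h.time_le hm hU)
    (fun i hi => h.step_le hU (by omega)) (fun u _ _ => hb u) (fun u _ _ => hb u)
    fun i hi _ hu => ?_
  obtain ⟨k, hs, hc, -⟩ := h.increment_of_not_isDisturbed hm hτ hT hU hi hu
  have h1 : (T k.castSucc : ℝ) ≠ 0 := by have := hT k.castSucc; positivity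
  have e1 : ∑ u ∈ Finset.Ico (τ i) (τ (i + 1)), (if ∃ j, τ j = u then (1 : ℝ) else 0) = 1 := by
    rw [Finset.sum_eq_single (τ i)]
    · exact if_pos ⟨i, rfl⟩
    · intro u hu hne
      have := Finset.mem_Ico.1 hu
      exact if_neg (hτ.not_exists_eq (by omega) this.2)
    · intro hne
      exact absurd (Finset.left_mem_Ico.2 (hτ (Nat.lt_succ_self i))) hne
  have e2 : ∑ u ∈ Finset.Ico (τ i) (τ (i + 1)), 1 / (T (σ u).castSucc : ℝ) = 1 := by
    rw [Finset.sum_congr (g := fun _ => 1 / (T k.castSucc : ℝ)) rfl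
      fun u hu => by rw [hc u (Finset.mem_Ico.1 hu).1 (Finset.mem_Ico.1 hu).2],
      Finset.sum_const, Nat.card_Ico, hs, Nat.add_sub_cancel_left, nsmul_eq_mul,
      mul_one_div_cancel h1]
  rw [Finset.sum_sub_distrib, e1, e2, sub_self]

end IsGreedyRun

/-- The reconstruction for deterministic estimates and sampling times. -/
noncomputable abbrev fixedReconstruction {Ω : Type u} {m : ℕ} (w : Fin 3 → (Fin m → ℕ) → ℕ → Fin m → ℝ)
    (κ : ℕ → Fin 3) (τ : ℕ → ℕ) (X : ℕ → Ω → ℝ) (s : ℕ) (ω : Ω) : ℝ :=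
  reconstruction w (fun i _ => κ i) (fun i _ => τ i) X s ω

section reconstruction

variable {Ω : Type u} {m : ℕ} {w : Fin 3 → (Fin m → ℕ) → ℕ → Fin m → ℝ} {κ : ℕ → Fin 3}
  {τ : ℕ → ℕ} {X : ℕ → Ω → ℝ} {s : ℕ}

theorem fixedReconstruction_of_sample (h : ∃ j, τ j = s) (ω : Ω) :
    fixedReconstruction w κ τ X s ω = X s ω := by
  simp only [fixedReconstruction, reconstruction]
  rw [if_pos h]

theorem fixedReconstruction_of_lt (h : ¬ ∃ j, τ j = s) (h' : s < τ (m - 1)) (ω : Ω) :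
    fixedReconstruction w κ τ X s ω = 0 := by
  simp only [fixedReconstruction, reconstruction]
  rw [if_neg h, if_neg (by omega)]

theorem fixedReconstruction_of_between (hτ : StrictMono τ) {i : ℕ} (hi : m ≤ i + 1)
    (h1 : τ i < s) (h2 : s < τ (i + 1)) (ω : Ω) :
    fixedReconstruction w κ τ X s ω =
      ∑ j : Fin m, w (κ i) (fun j' => τ i - τ (i - j')) (s - τ i) j * X (τ (i - j)) ω := by
  simp only [fixedReconstruction, reconstruction]
  have h3 : τ (m - 1) ≤ s := (hτ.monotone (by omega : m - 1 ≤ i)).trans h1.le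
  rw [if_neg (hτ.not_exists_eq h1 h2), if_pos h3, latestIndex_eq hτ h1.le h2]

/-- The weights are bounded as long as the offsets and the prediction horizon are. -/
theorem exists_weight_bound (w : Fin 3 → (Fin m → ℕ) → ℕ → Fin m → ℝ) (K : ℕ) :
    ∃ b : ℝ, ∀ k off l j, (∀ j, off j ≤ K) → l ≤ K → |w k off l j| ≤ b := by
  have hf : ((Set.univ : Set (Fin 3)) ×ˢ Set.Icc (0 : Fin m → ℕ) (fun _ => K) ×ˢ Set.Iic K ×ˢ
      (Set.univ : Set (Fin m))).Finite :=
    Set.finite_univ.prod ((Set.finite_Icc _ _).prod ((Set.finite_Iic _).prod Set.finite_univ))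
  obtain ⟨b, hb⟩ := (hf.image fun x => |w x.1 x.2.1 x.2.2.1 x.2.2.2|).bddAbove
  refine ⟨b, fun k off l j h1 h2 => hb ⟨(k, off, l, j), ⟨trivial, ⟨fun j => ?_, h1⟩, h2, trivial⟩,
    rfl⟩⟩
  exact Nat.zero_le _

end reconstruction

/-! ### Distortion along a run -/

section distortion

variable {Ω : Type u} [MeasurableSpace Ω] {Q : Measure Ω} {α : Fin 2 → ℝ} {σ : ℕ → Fin 2}
  {X : ℕ → Ω → ℝ} {M m : ℕ} {w : Fin 3 → (Fin m → ℕ) → ℕ → Fin m → ℝ} {κ : ℕ → Fin 3}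
  {τ : ℕ → ℕ} {s : ℕ}

/-- At every time the reconstruction is either exact, or zero, or a linear prediction. -/
theorem reconstruction_trichotomy (hm : 1 ≤ m) (hτ : StrictMono τ) (s : ℕ) :
    (∃ j, τ j = s) ∨ ((¬ ∃ j, τ j = s) ∧ s < τ (m - 1)) ∨
      ∃ i, m ≤ i + 1 ∧ τ i < s ∧ s < τ (i + 1) := by
  by_cases h1 : ∃ j, τ j = s
  · exact Or.inl h1
  rcases lt_or_ge s (τ (m - 1)) with h2 | h2
  · exact Or.inr (Or.inl ⟨h1, h2⟩)
  · obtain ⟨i, hi, h3, h4⟩ := hτ.exists_le_lt_succ h2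
    exact Or.inr (Or.inr ⟨i, by omega, lt_of_le_of_ne h3 fun h => h1 ⟨i, h⟩, h4⟩)

theorem HasARMoments.integrable_reconstruction_error (h : HasARMoments Q α σ X M) (hm : 1 ≤ m)
    (hτ : StrictMono τ) (hs : s ≤ M) :
    Integrable (fun ω => (X s ω - fixedReconstruction w κ τ X s ω) ^ 2) Q := by
  rcases reconstruction_trichotomy hm hτ s with h1 | ⟨h1, h2⟩ | ⟨i, hi, h1, h2⟩
  · simp [fixedReconstruction_of_sample h1]
  · simp only [fixedReconstruction_of_lt h1 h2, sub_zero]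
    exact (h.memLp s hs).integrable_sq
  · simp only [fixedReconstruction_of_between hτ hi h1 h2]
    refine h.integrable_sq_error hs (fun j => ?_) _
    exact (hτ.monotone (Nat.sub_le _ _)).trans (h1.le.trans hs)

theorem HasARMoments.integral_reconstruction_error_le (h : HasARMoments Q α σ X M) (hm : 1 ≤ m)
    (hτ : StrictMono τ) (hs : s ≤ M) {K : ℕ} {b : ℝ}
    (hb : ∀ k off l j, (∀ j, off j ≤ K) → l ≤ K → |w k off l j| ≤ b)
    (hK : ∀ i, m ≤ i + 1 → τ i < s → s < τ (i + 1) → s ≤ τ i + K ∧ τ i ≤ τ (i + 1 - m) + K) :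
    ∫ ω, (X s ω - fixedReconstruction w κ τ X s ω) ^ 2 ∂Q ≤
      2 * (1 + m ^ 2 * b ^ 2) * Q.real Set.univ := by
  have hq : 0 ≤ Q.real Set.univ := measureReal_nonneg
  rcases reconstruction_trichotomy hm hτ s with h1 | ⟨h1, h2⟩ | ⟨i, hi, h1, h2⟩
  · simp only [fixedReconstruction_of_sample h1]
    simp
    positivity
  · simp only [fixedReconstruction_of_lt h1 h2, sub_zero, sq (X s _)]
    rw [h.power s hs]
    have : 0 ≤ (m : ℝ) ^ 2 * b ^ 2 := by positivity
    nlinarith [mul_nonneg this hq]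
  · simp only [fixedReconstruction_of_between hτ hi h1 h2]
    obtain ⟨h3, h4⟩ := hK i hi h1 h2
    refine h.integral_sq_error_le hs
      (fun j => (hτ.monotone (Nat.sub_le _ _)).trans (h1.le.trans hs)) fun j => ?_
    refine hb _ _ _ _ (fun j' => ?_) (by omega)
    have : τ (i + 1 - m) ≤ τ (i - j') := hτ.monotone (by omega)
    omega

theorem HasARMoments.integral_reconstruction_error_of_const (h : HasARMoments Q α σ X M)
    (hm : 1 ≤ m) (hτ : StrictMono τ) (hs : s ≤ M) {k : Fin 2}
    (hw : IsGLPFilter (α k) (w k.castSucc)) {i : ℕ} (hi : m ≤ i + 1) (h1 : τ i < s)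
    (h2 : s < τ (i + 1)) (hκ : κ i = k.castSucc)
    (hk : ∀ v, τ (i + 1 - m) ≤ v → v < τ (i + 1) → σ v = k) :
    ∫ ω, (X s ω - fixedReconstruction w κ τ X s ω) ^ 2 ∂Q =
      (1 - α k ^ (2 * (s - τ i))) * Q.real Set.univ := by
  simp only [fixedReconstruction_of_between hτ hi h1 h2]
  have hle : ∀ j : Fin m, τ (i - j) ≤ τ i := fun j => hτ.monotone (Nat.sub_le _ _)
  refine h.integral_sq_error_of_const hs hle (lo := τ (i + 1 - m))
    (fun j => hτ.monotone (by omega)) ⟨0, hm⟩ rfl h1.le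
    (fun v hv1 hv2 => hk v hv1 (by omega)) fun v' => ?_
  have hoff : StrictMono fun j : Fin m => τ i - τ (i - j) := by
    intro j j' hjj
    have h3 : τ (i - j') < τ (i - j) := hτ (by omega)
    have := hle j
    simp only
    omega
  have h3 := hw _ hoff (s - τ i) (by omega) v'
  have h4 : (fun j : Fin m => s - τ i + (τ i - τ (i - j))) = fun j : Fin m => s - τ (i - j) := by
    funext j
    have := hle j
    omega
  rw [hκ]
  rwa [h4] at h3

variable {T : Fin 3 → ℕ} {t₀ : Fin m → ℕ} {U : ℕ}

open Classical in
-- Two weight bounds are kept apart: `b'` depends on `t₀` and multiplies only the length of the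
-- start, while `b` is free of `t₀` and multiplies the disturbed times.
theorem IsGreedyRun.abs_distortion_sub_le (hr : IsGreedyRun T t₀ σ κ τ) (hm : 1 ≤ m)
    (hτ : StrictMono τ) (hT : ∀ k, 1 ≤ T k) (hU : ∀ k, T k ≤ U) (h : HasARMoments Q α σ X M)
    {n : ℕ} (hn : n ≤ M) (hw : ∀ k : Fin 2, IsGLPFilter (α k) (w k.castSucc)) {b b' : ℝ}
    (hb : ∀ k off l j, (∀ j, off j ≤ m * U) → l ≤ m * U → |w k off l j| ≤ b)
    (hb' : ∀ k off l j, (∀ j, off j ≤ t₀ ⟨m - 1, by omega⟩ + (m + 1) * U) →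
      l ≤ t₀ ⟨m - 1, by omega⟩ + (m + 1) * U → |w k off l j| ≤ b')
    {d : Fin 2 → ℝ}
    (hd : ∀ k : Fin 2, ∑ l ∈ Finset.range (T k.castSucc), (1 - α k ^ (2 * l)) =
      T k.castSucc * d k) :
    |∑ u ∈ Finset.range n, (∫ ω, (X u ω - fixedReconstruction w κ τ X u ω) ^ 2 ∂Q -
        d (σ u) * Q.real Set.univ)| ≤
      ((2 * (1 + m ^ 2 * b' ^ 2) + (|d 0| + |d 1|)) * (t₀ ⟨m - 1, by omega⟩ + (m + 1) * U : ℕ) +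
        (2 * (1 + m ^ 2 * b ^ 2) + (|d 0| + |d 1|)) *
          (U + ∑ u ∈ Finset.range n, if IsDisturbed U (m * U) σ u then 1 else 0)) *
        Q.real Set.univ := by
  have hq : 0 ≤ Q.real Set.univ := measureReal_nonneg
  have hbd : ∀ (c : ℝ) u, ∫ ω, (X u ω - fixedReconstruction w κ τ X u ω) ^ 2 ∂Q ≤
      2 * (1 + m ^ 2 * c ^ 2) * Q.real Set.univ →
      |∫ ω, (X u ω - fixedReconstruction w κ τ X u ω) ^ 2 ∂Q - d (σ u) * Q.real Set.univ| ≤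
        (2 * (1 + m ^ 2 * c ^ 2) + (|d 0| + |d 1|)) * Q.real Set.univ := by
    intro c u hc
    have h1 : 0 ≤ ∫ ω, (X u ω - fixedReconstruction w κ τ X u ω) ^ 2 ∂Q :=
      integral_nonneg fun ω => sq_nonneg _
    have h2 : ∀ k : Fin 2, |d k| ≤ |d 0| + |d 1| := fun k => by
      have := abs_nonneg (d 0)
      have := abs_nonneg (d 1)
      fin_cases k <;> simp
    refine (abs_sub _ _).trans ?_
    rw [abs_mul, abs_of_nonneg hq, abs_of_nonneg h1, add_mul]
    exact add_le_add hc (mul_le_mul_of_nonneg_right (h2 _) hq)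
  rw [add_mul, mul_right_comm, mul_right_comm (2 * (1 + (m : ℝ) ^ 2 * b ^ 2) + (|d 0| + |d 1|))]
  refine abs_sum_range_le (by positivity) (by positivity) hτ (hr.time_le hm hU)
    (fun i hi => hr.step_le hU (by omega)) (fun u hu hu0 => ?_) (fun u hu hu0 => ?_)
    fun i hi hin hu => ?_
  · have h0 := hr.time_le hm hU
    exact hbd b' u (h.integral_reconstruction_error_le hm hτ (by omega) hb'
      fun i hi h1 h2 => ⟨by omega, by omega⟩)
  · refine hbd b u (h.integral_reconstruction_error_le hm hτ (by omega) hb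
      fun i hi h1 h2 => ?_)
    -- From index `2 * m` on, the whole sampling state was produced by greedy steps, which bounds
    -- all offsets by `m * U`.
    have hi2 : 2 * m ≤ i := by
      have := hτ.lt_iff_lt.1 (hu0.trans_lt h2)
      omega
    have h3 := hr.step_le hU hi
    have h4 := hr.time_add_le hU (i := i + 1 - m) (by omega) (m - 1)
    rw [show i + 1 - m + (m - 1) = i by omega] at h4
    have h5 : (m - 1) * U ≤ m * U := Nat.mul_le_mul_right _ (by omega)
    have h6 : U ≤ m * U := Nat.le_mul_of_pos_left _ hm
    omega
  · obtain ⟨k, hs, hc, hk⟩ := hr.increment_of_not_isDisturbed hm hτ hT hU hi hu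
    have he : ∀ u ∈ Finset.Ico (τ i) (τ (i + 1)),
        ∫ ω, (X u ω - fixedReconstruction w κ τ X u ω) ^ 2 ∂Q - d (σ u) * Q.real Set.univ =
        ((1 - α k ^ (2 * (u - τ i))) - d k) * Q.real Set.univ := by
      intro u hu
      obtain ⟨hu1, hu2⟩ := Finset.mem_Ico.1 hu
      rw [hc u hu1 hu2, sub_mul]
      congr 1
      rcases hu1.eq_or_lt with rfl | hu1
      · simp [fixedReconstruction_of_sample (⟨i, rfl⟩ : ∃ j, τ j = τ i)]
      · rcases hk with hk | ⟨hκ, hk⟩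
        · omega
        · exact h.integral_reconstruction_error_of_const hm hτ (by omega) (hw k) (by omega) hu1 hu2
            hκ hk
    rw [Finset.sum_congr rfl he, ← Finset.sum_mul, Finset.sum_sub_distrib, hs,
      Finset.sum_Ico_eq_sum_range, Finset.sum_const, Nat.card_Ico, Nat.add_sub_cancel_left,
      Finset.sum_congr (g := fun l => 1 - α k ^ (2 * l)) rfl
        fun l _ => by rw [Nat.add_sub_cancel_left], hd, nsmul_eq_mul, sub_self, zero_mul]

end distortion

/-! ### The random scheme -/

theorem IsGreedyRun.fixedReconstruction_congr {Ω : Type u} {m : ℕ} {T : Fin 3 → ℕ}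
    {t₀ : Fin m → ℕ} {σ σ' : ℕ → Fin 2} {κ κ' : ℕ → Fin 3} {τ τ' : ℕ → ℕ}
    (h : IsGreedyRun T t₀ σ κ τ) (h' : IsGreedyRun T t₀ σ' κ' τ') (hm : 1 ≤ m)
    (hτ : StrictMono τ) (hτ' : StrictMono τ') {n : ℕ} (hσ : ∀ i ≤ n, σ i = σ' i) {s : ℕ}
    (hs : s ≤ n) (w : Fin 3 → (Fin m → ℕ) → ℕ → Fin m → ℝ) (X : ℕ → Ω → ℝ) (ω : Ω) :
    fixedReconstruction w κ' τ' X s ω = fixedReconstruction w κ τ X s ω := by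
  have hiff := h.congr_time_iff h' hm hτ hτ' hσ hs
  have hex : (∃ j, τ' j = s) ↔ ∃ j, τ j = s := exists_congr fun j => (hiff j).2
  rcases reconstruction_trichotomy hm hτ s with h1 | ⟨h1, h2⟩ | ⟨i, hi, h1, h2⟩
  · rw [fixedReconstruction_of_sample h1, fixedReconstruction_of_sample (hex.2 h1)]
  · rw [fixedReconstruction_of_lt h1 h2, fixedReconstruction_of_lt (fun h => h1 (hex.1 h))]
    have := (hiff (m - 1)).1
    omega
  · have e : ∀ j, j ≤ i → τ' j = τ j := fun j hj =>
      h.congr_time h' hm hτ hσ j ((hτ.monotone hj).trans (h1.le.trans hs))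
    have h3 := (hiff (i + 1)).1
    rw [fixedReconstruction_of_between hτ hi h1 h2,
      fixedReconstruction_of_between hτ' hi (by rwa [e i le_rfl]) (by omega),
      h.congr_est h' hm hτ hσ hi (h1.le.trans hs), e i le_rfl]
    simp_rw [fun j : Fin m => e (i - j) (Nat.sub_le _ _)]

theorem sum_state_sub {Ω : Type u} {θ : ℕ → Ω → Fin 2} (r : Fin 2 → ℝ) (n : ℕ) (ω : Ω) :
    ∑ u ∈ Finset.range n, r (θ u ω) - n * (r 0 / 2 + r 1 / 2) =
      (r 0 - r 1) / 2 * ∑ u ∈ Finset.range n, stateSign (θ u ω) := by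
  rw [Finset.sum_congr rfl fun u _ => eq_average_add_stateSign r (θ u ω), Finset.sum_add_distrib,
    ← Finset.mul_sum]
  simp
  ring

section scheme

variable {Ω : Type u} [MeasurableSpace Ω] {P : Measure Ω}
  {sel : (ℕ → ℝ) → ℕ} {α : Fin 2 → ℝ} {s2 ρ : ℝ} {m : ℕ} {t₀ : Fin m → ℕ} {θ : ℕ → Ω → Fin 2}
  {θhat : ℕ → Ω → Fin 3} {t : ℕ → Ω → ℕ}

theorem IsGreedyScheme.measurable_time (h : IsGreedyScheme P sel α s2 ρ m t₀ θ θhat t)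
    (hm : 1 ≤ m) (i : ℕ) : Measurable (t i) := by
  induction i with
  | zero =>
    rw [show t 0 = fun _ => t₀ ⟨0, hm⟩ from funext fun ω => h.init ⟨0, hm⟩ ω]
    exact measurable_const
  | succ i ih =>
    rcases lt_or_ge (i + 1) m with hi | hi
    · rw [show t (i + 1) = fun _ => t₀ ⟨i + 1, hi⟩ from funext fun ω => h.init ⟨i + 1, hi⟩ ω]
      exact measurable_const
    · rw [show t (i + 1) = _ from funext fun ω => h.step i hi ω]
      exact ih.add ((measurable_of_countable fun k =>
        greedyStep sel α (estError P m θ t θhat i) s2 ρ k).comp (h.measurable_est i))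

variable [IsProbabilityMeasure P]

/-- Each estimate is wrong on a null set only, and there are countably many of them. -/
theorem IsGreedyScheme.ae_isGreedyRun (h : IsGreedyScheme P sel α s2 ρ m t₀ θ θhat t)
    (he : ∀ i, m ≤ i + 1 → estError P m θ t θhat i = 0) :
    ∀ᵐ ω ∂P, IsGreedyRun (greedyStep sel α 0 s2 ρ) t₀ (fun i => θ i ω) (fun i => θhat i ω)
      (fun i => t i ω) := by
  have h1 : ∀ i, ∀ᵐ ω ∂P, m ≤ i + 1 → θhat i ω = samplingState m θ t i ω := by
    intro i
    by_cases hi : m ≤ i + 1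
    · have h2 := he i hi
      rw [estError, measureReal_eq_zero_iff] at h2
      filter_upwards [show ∀ᵐ ω ∂P, θhat i ω = samplingState m θ t i ω from h2] with ω hω _
      exact hω
    · exact Filter.Eventually.of_forall fun ω hi' => absurd hi' hi
  filter_upwards [ae_all_iff.2 h1] with ω hω
  exact ⟨fun i => h.init i ω, hω, fun i hi => by rw [h.step i hi, he i hi]⟩

theorem IsGreedyScheme.integrable_samplingRate (h : IsGreedyScheme P sel α s2 ρ m t₀ θ θhat t)
    (hm : 1 ≤ m) (n : ℕ) : Integrable (samplingRate t n) P := by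
  classical
  have e : samplingRate t n = fun ω =>
      (∑ s ∈ Finset.range n, {ω | ∃ j, t j ω = s}.indicator (fun _ => (1 : ℝ)) ω) / n := by
    funext ω
    rw [samplingRate, Finset.card_filter]
    push_cast
    rfl
  rw [e]
  refine (integrable_finsetSum _ fun s _ => (integrable_const 1).indicator ?_).div_const _
  rw [Set.ofPred_exists]
  exact MeasurableSet.iUnion fun j => h.measurable_time hm j (measurableSet_singleton s)

variable {p : ℝ}

/-- The number of disturbed times before `n`. -/
noncomputable def disturbedCount (U L n : ℕ) (σ : ℕ → Fin 2) : ℝ :=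
  open Classical in ∑ u ∈ Finset.range n, if IsDisturbed U L σ u then 1 else 0

theorem disturbedCount_congr {U L n : ℕ} {σ σ' : ℕ → Fin 2} (h : ∀ i ≤ n + L + 1, σ i = σ' i) :
    disturbedCount U L n σ = disturbedCount U L n σ' := by
  classical
  refine Finset.sum_congr rfl fun u hu => ?_
  have hu := Finset.mem_range.1 hu
  have : IsDisturbed U L σ u ↔ IsDisturbed U L σ' u := by
    refine and_congr_right fun _ => exists_congr fun v => and_congr_right fun _ =>
      and_congr_right fun hv => ?_
    rw [h v (by omega), h (v + 1) (by omega)]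
  simp only [this]

theorem IsSymmetricChain.integrable_disturbedCount (h : IsSymmetricChain P p θ) (U L n : ℕ) :
    Integrable (fun ω => disturbedCount U L n fun t => θ t ω) P :=
  integrable_finsetSum _ fun u _ => h.integrable_disturbed U L u

theorem IsSymmetricChain.integral_disturbedCount_le (h : IsSymmetricChain P p θ) {U L : ℕ} {δ : ℝ}
    (hδ : 0 ≤ δ) (hp : 2 ≤ U → p ≤ δ) (n : ℕ) :
    ∫ ω, disturbedCount U L n (fun t => θ t ω) ∂P ≤ n * ((2 * L + 1) * δ) := by
  unfold disturbedCount
  rw [integral_finsetSum _ fun u _ => h.integrable_disturbed U L u]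
  simpa using Finset.sum_le_card_nsmul (Finset.range n) _ _
    fun u _ => h.integral_disturbed_le (L := L) hδ hp u

theorem integrable_sum_state (hθ : ∀ t, Measurable (θ t)) (r : Fin 2 → ℝ) (n : ℕ) :
    Integrable (fun ω => ∑ u ∈ Finset.range n, r (θ u ω)) P :=
  integrable_comp_path hθ (Finset.range n) (fun x => ∑ u ∈ Finset.range n, r (x u))
    fun x y hxy => Finset.sum_congr rfl fun u hu => by rw [hxy u hu]

theorem IsSymmetricChain.integral_abs_sum_state_sub_le (h : IsSymmetricChain P p θ) (hp : 0 < p)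
    (hp1 : p ≤ 1) {η : ℝ} (hη : 0 < η) (r : Fin 2 → ℝ) (n : ℕ) :
    ∫ ω, |∑ u ∈ Finset.range n, r (θ u ω) - n * (r 0 / 2 + r 1 / 2)| ∂P ≤
      |(r 0 - r 1) / 2| * (η * n + (1 + 1 / p) / η) := by
  simp_rw [sum_state_sub, abs_mul]
  rw [integral_const_mul]
  exact mul_le_mul_of_nonneg_left (h.integral_abs_sum_sign_le hp hp1 hη n) (abs_nonneg _)

theorem integral_abs_samplingRate_sub_le {U n : ℕ} {δ η : ℝ} (hm : 1 ≤ m) (ht₀ : StrictMono t₀)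
    (hT : ∀ k, 1 ≤ greedyStep sel α 0 s2 ρ k) (hU : ∀ k, greedyStep sel α 0 s2 ρ k ≤ U)
    (hc : IsSymmetricChain P p θ) (hp : 0 < p) (hp1 : p ≤ 1)
    (hs : IsGreedyScheme P sel α s2 ρ m t₀ θ θhat t)
    (he : ∀ i, m ≤ i + 1 → estError P m θ t θhat i = 0) (hn : 1 ≤ n) (hδ : 0 ≤ δ)
    (hpδ : 2 ≤ U → p ≤ δ) (hη : 0 < η) {r : Fin 2 → ℝ}
    (hr : ∀ k : Fin 2, r k = 1 / (greedyStep sel α 0 s2 ρ k.castSucc : ℝ)) :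
    n * ∫ ω, |samplingRate t n ω - (r 0 / 2 + r 1 / 2)| ∂P ≤
      (1 * (t₀ ⟨m - 1, by omega⟩ + (m + 1) * U : ℕ) +
        1 * (U + n * ((2 * (m * U : ℕ) + 1) * δ))) +
        |(r 0 - r 1) / 2| * (η * n + (1 + 1 / p) / η) := by
  classical
  have hn' : (n : ℝ) ≠ 0 := by positivity
  set S : ℝ := ((t₀ ⟨m - 1, by omega⟩ + (m + 1) * U : ℕ) : ℝ) with hS
  have hpt : ∀ᵐ ω ∂P, n * |samplingRate t n ω - (r 0 / 2 + r 1 / 2)| ≤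
      (1 * S + 1 * (U + disturbedCount U (m * U) n fun i => θ i ω)) +
        |∑ u ∈ Finset.range n, r (θ u ω) - n * (r 0 / 2 + r 1 / 2)| := by
    filter_upwards [hs.ae_isGreedyRun he] with ω hω
    have h1 := hω.abs_rate_sub_le hm (hω.strictMono hT ht₀) hT hU n
    have h2 : (n : ℝ) * samplingRate t n ω =
        ∑ u ∈ Finset.range n, if ∃ j, t j ω = u then (1 : ℝ) else 0 := by
      rw [samplingRate, mul_div_cancel₀ _ hn', Finset.card_filter]
      push_cast
      rfl
    simp_rw [← hr] at h1
    rw [Finset.sum_sub_distrib, ← h2] at h1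
    have h3 : (n : ℝ) * |samplingRate t n ω - (r 0 / 2 + r 1 / 2)| =
        |(n * samplingRate t n ω - ∑ u ∈ Finset.range n, r (θ u ω)) +
          (∑ u ∈ Finset.range n, r (θ u ω) - n * (r 0 / 2 + r 1 / 2))| := by
      rw [sub_add_sub_cancel, ← mul_sub, abs_mul, Nat.abs_cast]
    rw [h3]
    exact (abs_add_le _ _).trans (add_le_add_left h1 _)
  have i1 := (hs.integrable_samplingRate hm n).sub (integrable_const (r 0 / 2 + r 1 / 2))
  have i2 : Integrable (fun ω => 1 * ((U : ℝ) + disturbedCount U (m * U) n fun i => θ i ω)) P :=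
    ((integrable_const _).add (hc.integrable_disturbedCount U (m * U) n)).const_mul 1
  have i3 : Integrable
      (fun ω => 1 * S + 1 * (U + disturbedCount U (m * U) n fun i => θ i ω)) P :=
    (integrable_const _).add i2
  have i4 : Integrable
      (fun ω => |∑ u ∈ Finset.range n, r (θ u ω) - n * (r 0 / 2 + r 1 / 2)|) P :=
    ((integrable_sum_state hc.measurable r n).sub (integrable_const _)).abs
  rw [← integral_const_mul]
  refine (integral_mono_ae (i1.abs.const_mul _) (i3.add i4) hpt).trans ?_
  simp only [Pi.add_apply]
  rw [integral_add i3 i4, integral_add (integrable_const _) i2, integral_const, integral_const_mul,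
    integral_add (integrable_const _) (hc.integrable_disturbedCount U (m * U) n)]
  have h1 := hc.integral_disturbedCount_le (L := m * U) hδ hpδ n
  have h2 := hc.integral_abs_sum_state_sub_le hp hp1 hη r n
  simp only [integral_const, probReal_univ, one_smul, one_mul]
  linarith

variable {Z : Fin 2 → ℕ → Ω → ℝ} {X : ℕ → Ω → ℝ}

/-- By causality, almost all outcomes in the event share sampling times and estimates up to `M`, so
the bound for a deterministic run applies. `M` exceeds `n` by `m * U + 1` because disturbance at a
time before `n` depends on the chain that far ahead. -/
theorem distortion_on_pathEvent {U n M : ℕ} (hm : 1 ≤ m) (ht₀ : StrictMono t₀)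
    (hα : ∀ k, |α k| < 1)
    (hT : ∀ k, 1 ≤ greedyStep sel α 0 s2 ρ k) (hU : ∀ k, greedyStep sel α 0 s2 ρ k ≤ U)
    (hc : IsSymmetricChain P p θ) (hX : IsMarkovianSignal P α θ Z X)
    (hs : IsGreedyScheme P sel α s2 ρ m t₀ θ θhat t)
    (he : ∀ i, m ≤ i + 1 → estError P m θ t θhat i = 0)
    {w : Fin 3 → (Fin m → ℕ) → ℕ → Fin m → ℝ}
    (hw : ∀ k : Fin 2, IsGLPFilter (α k) (w k.castSucc)) {b b' : ℝ}
    (hb : ∀ k off l j, (∀ j, off j ≤ m * U) → l ≤ m * U → |w k off l j| ≤ b)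
    (hb' : ∀ k off l j, (∀ j, off j ≤ t₀ ⟨m - 1, by omega⟩ + (m + 1) * U) →
      l ≤ t₀ ⟨m - 1, by omega⟩ + (m + 1) * U → |w k off l j| ≤ b')
    {d : Fin 2 → ℝ}
    (hd : ∀ k : Fin 2, ∑ l ∈ Finset.range (greedyStep sel α 0 s2 ρ k.castSucc),
      (1 - α k ^ (2 * l)) = greedyStep sel α 0 s2 ρ k.castSucc * d k)
    (hM : M = n + m * U + 1) (s : ℕ → Fin 2) :
    IntegrableOn (fun ω => ∑ u ∈ Finset.range n, (X u ω - reconstruction w θhat t X u ω) ^ 2)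
        (pathEvent θ M s) P ∧
      |∫ ω in pathEvent θ M s, ∑ u ∈ Finset.range n, (X u ω - reconstruction w θhat t X u ω) ^ 2 ∂P -
          ∫ ω in pathEvent θ M s, ∑ u ∈ Finset.range n, d (θ u ω) ∂P| ≤
        ∫ ω in pathEvent θ M s,
          ((2 * (1 + m ^ 2 * b' ^ 2) + (|d 0| + |d 1|)) *
              (t₀ ⟨m - 1, by omega⟩ + (m + 1) * U : ℕ) +
            (2 * (1 + m ^ 2 * b ^ 2) + (|d 0| + |d 1|)) *
              (U + disturbedCount U (m * U) n fun i => θ i ω)) ∂P := by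
  have hAm := measurableSet_pathEvent hc.measurable M s
  have hrun := hs.ae_isGreedyRun he
  -- An outcome `ω₀` supplies the run, and its own path replaces `s`, since a run is tied to the
  -- path at all times. Without such an outcome the event is null.
  by_cases hne : ∃ ω₀ ∈ pathEvent θ M s, IsGreedyRun (greedyStep sel α 0 s2 ρ) t₀
      (fun i => θ i ω₀) (fun i => θhat i ω₀) (fun i => t i ω₀)
  · obtain ⟨ω₀, hω₀, hr⟩ := hne
    have hτ := hr.strictMono hT ht₀
    have hA : pathEvent θ M s = {ω | ∀ i, i ≤ M → θ i ω = θ i ω₀} := by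
      ext ω
      exact forall₂_congr fun i hi => by rw [hω₀ i hi]
    have hmom := hX.hasARMoments hα hc.measurable (fun i => θ i ω₀) M
    rw [← hA] at hmom
    have hq : (P.restrict (pathEvent θ M s)).real Set.univ = P.real (pathEvent θ M s) := by
      simp [measureReal_def]
    have hcongr : (fun ω => ∑ u ∈ Finset.range n, (X u ω - reconstruction w θhat t X u ω) ^ 2)
        =ᵐ[P.restrict (pathEvent θ M s)] fun ω => ∑ u ∈ Finset.range n, (X u ω -
          fixedReconstruction w (fun i => θhat i ω₀) (fun i => t i ω₀) X u ω) ^ 2 := by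
      filter_upwards [ae_restrict_mem hAm, ae_restrict_of_ae hrun] with ω hω hr'
      refine Finset.sum_congr rfl fun u hu => ?_
      have hu := Finset.mem_range.1 hu
      rw [← hr.fixedReconstruction_congr hr' hm hτ (hr'.strictMono hT ht₀) (n := M) (s := u)
        (fun i hi => (hω₀ i hi).trans (hω i hi).symm) (by omega) w X ω]
      rfl
    have hint : ∀ u ∈ Finset.range n, Integrable (fun ω => (X u ω -
        fixedReconstruction w (fun i => θhat i ω₀) (fun i => t i ω₀) X u ω) ^ 2)
        (P.restrict (pathEvent θ M s)) := fun u hu =>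
      hmom.integrable_reconstruction_error hm hτ (by have := Finset.mem_range.1 hu; omega)
    refine ⟨(integrable_congr hcongr).2 (integrable_finsetSum _ hint), ?_⟩
    have e1 : ∫ ω in pathEvent θ M s, ∑ u ∈ Finset.range n, d (θ u ω) ∂P =
        ∑ u ∈ Finset.range n, d (θ u ω₀) * (P.restrict (pathEvent θ M s)).real Set.univ := by
      rw [setIntegral_congr_fun (g := fun _ => ∑ u ∈ Finset.range n, d (θ u ω₀)) hAm
        fun ω hω => Finset.sum_congr rfl fun u hu => by
          have := Finset.mem_range.1 hu
          rw [hω u (by omega), hω₀ u (by omega)],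
        setIntegral_const, hq, smul_eq_mul, mul_comm, Finset.sum_mul]
    rw [integral_congr_ae hcongr, integral_finsetSum _ hint, e1, ← Finset.sum_sub_distrib]
    refine (hr.abs_distortion_sub_le hm hτ hT hU hmom (by omega) hw hb hb' hd).trans
      (le_of_eq ?_)
    rw [setIntegral_congr_fun (g := fun _ => ((2 * (1 + m ^ 2 * b' ^ 2) + (|d 0| + |d 1|)) *
              (t₀ ⟨m - 1, by omega⟩ + (m + 1) * U : ℕ) +
            (2 * (1 + m ^ 2 * b ^ 2) + (|d 0| + |d 1|)) *
              (U + disturbedCount U (m * U) n fun i => θ i ω₀))) hAm fun ω hω => by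
          simp only
          rw [disturbedCount_congr (σ := fun i => θ i ω) (σ' := fun i => θ i ω₀)
            fun i hi => (hω i (by omega)).trans (hω₀ i (by omega)).symm],
      setIntegral_const, hq, smul_eq_mul, mul_comm]
    rfl
  · have h0 : P (pathEvent θ M s) = 0 := by
      refine measure_mono_null (fun ω hω hr => hne ⟨ω, hω, hr⟩) hrun
    have h1 : P.restrict (pathEvent θ M s) = 0 := Measure.restrict_eq_zero.2 h0
    rw [IntegrableOn, h1]
    simp

theorem integral_distortion_sub_le {U n : ℕ} {δ η : ℝ} (hm : 1 ≤ m) (ht₀ : StrictMono t₀)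
    (hα : ∀ k, |α k| < 1)
    (hT : ∀ k, 1 ≤ greedyStep sel α 0 s2 ρ k) (hU : ∀ k, greedyStep sel α 0 s2 ρ k ≤ U)
    (hc : IsSymmetricChain P p θ) (hp : 0 < p) (hp1 : p ≤ 1) (hX : IsMarkovianSignal P α θ Z X)
    (hs : IsGreedyScheme P sel α s2 ρ m t₀ θ θhat t)
    (he : ∀ i, m ≤ i + 1 → estError P m θ t θhat i = 0)
    {w : Fin 3 → (Fin m → ℕ) → ℕ → Fin m → ℝ}
    (hw : ∀ k : Fin 2, IsGLPFilter (α k) (w k.castSucc)) {b b' : ℝ}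
    (hb : ∀ k off l j, (∀ j, off j ≤ m * U) → l ≤ m * U → |w k off l j| ≤ b)
    (hb' : ∀ k off l j, (∀ j, off j ≤ t₀ ⟨m - 1, by omega⟩ + (m + 1) * U) →
      l ≤ t₀ ⟨m - 1, by omega⟩ + (m + 1) * U → |w k off l j| ≤ b')
    {d : Fin 2 → ℝ}
    (hd : ∀ k : Fin 2, ∑ l ∈ Finset.range (greedyStep sel α 0 s2 ρ k.castSucc),
      (1 - α k ^ (2 * l)) = greedyStep sel α 0 s2 ρ k.castSucc * d k)
    (hn : 1 ≤ n) (hδ : 0 ≤ δ) (hpδ : 2 ≤ U → p ≤ δ) (hη : 0 < η) :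
    Integrable (sqDistortion X (reconstruction w θhat t X) n) P ∧
      n * |∫ ω, sqDistortion X (reconstruction w θhat t X) n ω ∂P - (d 0 / 2 + d 1 / 2)| ≤
        ((2 * (1 + m ^ 2 * b' ^ 2) + (|d 0| + |d 1|)) *
            (t₀ ⟨m - 1, by omega⟩ + (m + 1) * U : ℕ) +
          (2 * (1 + m ^ 2 * b ^ 2) + (|d 0| + |d 1|)) *
            (U + n * ((2 * (m * U : ℕ) + 1) * δ))) +
          |(d 0 - d 1) / 2| * (η * n + (1 + 1 / p) / η) := by
  have hn' : (n : ℝ) ≠ 0 := by positivity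
  have hpath := distortion_on_pathEvent hm ht₀ hα hT hU hc hX hs he hw hb hb' hd
    (rfl : n + m * U + 1 = n + m * U + 1)
  set C' : ℝ := 2 * (1 + m ^ 2 * b' ^ 2) + (|d 0| + |d 1|)
  set C : ℝ := 2 * (1 + m ^ 2 * b ^ 2) + (|d 0| + |d 1|) with hC
  have hC0 : 0 ≤ C := by positivity
  set S : ℝ := ((t₀ ⟨m - 1, by omega⟩ + (m + 1) * U : ℕ) : ℝ)
  set E : Ω → ℝ := fun ω => ∑ u ∈ Finset.range n, (X u ω - reconstruction w θhat t X u ω) ^ 2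
    with hE
  set M := n + m * U + 1
  have iE : Integrable E P := integrable_of_pathEvent (θ := θ) M fun x => (hpath _).1
  have iD := integrable_sum_state (P := P) hc.measurable d n
  have i2 : Integrable (fun ω => C * ((U : ℝ) + disturbedCount U (m * U) n fun i => θ i ω)) P :=
    ((integrable_const _).add (hc.integrable_disturbedCount U (m * U) n)).const_mul C
  have i3 : Integrable
      (fun ω => C' * S + C * (U + disturbedCount U (m * U) n fun i => θ i ω)) P :=
    (integrable_const _).add i2
  have e : sqDistortion X (reconstruction w θhat t X) n = fun ω => E ω / n := rfl
  rw [e]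
  refine ⟨iE.div_const _, ?_⟩
  have h1 : |∫ ω, E ω ∂P - ∫ ω, ∑ u ∈ Finset.range n, d (θ u ω) ∂P| ≤
      ∫ ω, (C' * S + C * (U + disturbedCount U (m * U) n fun i => θ i ω)) ∂P := by
    rw [integral_eq_sum_pathEvent hc.measurable M fun x => iE.integrableOn,
      integral_eq_sum_pathEvent hc.measurable M fun x => iD.integrableOn,
      integral_eq_sum_pathEvent hc.measurable M fun x => i3.integrableOn,
      ← Finset.sum_sub_distrib]
    exact (Finset.abs_sum_le_sum_abs _ _).trans (Finset.sum_le_sum fun x _ => (hpath _).2)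
  rw [integral_add (integrable_const _) i2, integral_const, integral_const_mul,
    integral_add (integrable_const _) (hc.integrable_disturbedCount U (m * U) n)] at h1
  simp only [integral_const, probReal_univ, one_smul] at h1
  have h2 := mul_le_mul_of_nonneg_left
    (hc.integral_disturbedCount_le (L := m * U) hδ hpδ n) hC0
  have h3 := hc.integral_abs_sum_state_sub_le hp hp1 hη d n
  have h4 : |∫ ω, ∑ u ∈ Finset.range n, d (θ u ω) ∂P - n * (d 0 / 2 + d 1 / 2)| ≤
      ∫ ω, |∑ u ∈ Finset.range n, d (θ u ω) - n * (d 0 / 2 + d 1 / 2)| ∂P := by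
    have h5 := integral_sub iD (integrable_const (n * (d 0 / 2 + d 1 / 2)) (μ := P))
    simp only [integral_const, probReal_univ, one_smul] at h5
    rw [← h5]
    exact abs_integral_le_integral_abs
  have h6 : (n : ℝ) * |∫ ω, E ω / n ∂P - (d 0 / 2 + d 1 / 2)| =
      |(∫ ω, E ω ∂P - ∫ ω, ∑ u ∈ Finset.range n, d (θ u ω) ∂P) +
        (∫ ω, ∑ u ∈ Finset.range n, d (θ u ω) ∂P - n * (d 0 / 2 + d 1 / 2))| := by
    rw [sub_add_sub_cancel, integral_div, ← Nat.abs_cast n, ← abs_mul, mul_sub, Nat.abs_cast,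
      mul_div_cancel₀ _ hn']
  rw [h6]
  refine (abs_add_le _ _).trans ?_
  rw [mul_add C] at h1 ⊢
  linarith

end scheme

/-! ### Choice of the constants and conclusion -/

theorem exists_horizon {C' C L c ε p η δ : ℝ} (U : ℝ) (S : ℝ) (hε : 0 < ε)
    (hδ : C * (L * δ) ≤ ε / 4) (hη : c * η ≤ ε / 4) :
    ∃ N : ℕ, 1 ≤ N ∧ ∀ n : ℕ, N ≤ n →
      (C' * S + C * (U + n * (L * δ))) + c * (η * n + (1 + 1 / p) / η) ≤ n * ε := by
  -- The terms linear in `n` use up `n * ε / 2`; the other half must dominate the constant terms.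
  obtain ⟨N, hN⟩ := exists_nat_ge ((C' * S + C * U + c * ((1 + 1 / p) / η)) * (2 / ε))
  refine ⟨N + 1, by omega, fun n hn => ?_⟩
  have h1 : (N : ℝ) ≤ n := by exact_mod_cast (Nat.le_succ N).trans hn
  have h2 := hN.trans h1
  have h0 : (0 : ℝ) ≤ n := Nat.cast_nonneg n
  have h3 := mul_le_mul_of_nonneg_left hδ h0
  have h4 := mul_le_mul_of_nonneg_left hη h0
  have h5 := mul_le_mul_of_nonneg_right h2 (half_pos hε).le
  have h6 : (C' * S + C * U + c * ((1 + 1 / p) / η)) * (2 / ε) * (ε / 2) =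
      C' * S + C * U + c * ((1 + 1 / p) / η) := by
    field_simp
  rw [h6] at h5
  linarith

theorem mainTheorem6
    (sel : (ℕ → ℝ) → ℕ) (hsel : IsArgMinRule sel)
    (α : Fin 2 → ℝ) (hα : ∀ k, |α k| < 1)
    (ρ : ℝ) (hρ : 0 < ρ) (s2 : ℝ) (hs2 : 1 ≤ s2)
    (m : ℕ) (hm : 1 ≤ m)
    (w : Fin 3 → (Fin m → ℕ) → ℕ → Fin m → ℝ)
    (hw : ∀ k : Fin 2, IsGLPFilter (α k) (w k.castSucc))
    (Tup : ℕ) (hTup : ∀ k : Fin 3, greedyStep sel α 0 s2 ρ k ≤ Tup) :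
    -- the bounds coincide for `P_e = 0`
    (rateLowerBound sel α 0 s2 ρ = genieRate sel α ρ ∧
      rateUpperBound sel α 0 s2 ρ = genieRate sel α ρ ∧
      distLowerBound sel α 0 0 s2 ρ = genieDistortion sel α ρ ∧
      distUpperBound sel α 0 0 s2 ρ = genieDistortion sel α ρ) ∧
    -- the pair is achieved when the chain is slow and the time horizon is large
    ∀ ε : ℝ, 0 < ε → ∃ δ : ℝ, 0 < δ ∧
      ∀ p : ℝ, 0 < p → p ≤ 1 → 1 - δ < (1 - p) ^ (Tup - 1) →
      ∀ t₀ : Fin m → ℕ, StrictMono t₀ →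
      ∃ N : ℕ, ∀ n : ℕ, N ≤ n →
      ∀ (Ω : Type u) [MeasurableSpace Ω] (P : Measure Ω) [IsProbabilityMeasure P]
        (θ : ℕ → Ω → Fin 2) (Z : Fin 2 → ℕ → Ω → ℝ) (X : ℕ → Ω → ℝ)
        (θhat : ℕ → Ω → Fin 3) (t : ℕ → Ω → ℕ),
        IsSymmetricChain P p θ →
        IsMarkovianSignal P α θ Z X →
        IsGreedyScheme P sel α s2 ρ m t₀ θ θhat t →
        (∀ i, m ≤ i + 1 → estError P m θ t θhat i = 0) →
        Integrable (samplingRate t n) P ∧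
        ∫ ω, |samplingRate t n ω - genieRate sel α ρ| ∂P ≤ ε ∧
        Integrable (sqDistortion X (reconstruction w θhat t X) n) P ∧
        |∫ ω, sqDistortion X (reconstruction w θhat t X) n ω ∂P - genieDistortion sel α ρ|
          ≤ ε := by
  refine ⟨bounds_eq_genie sel α s2 ρ, fun ε hε => ?_⟩
  obtain ⟨b, hb⟩ := exists_weight_bound w (m * Tup)
  set r : Fin 2 → ℝ := fun k => 1 / (genieStep sel (α k) ρ : ℝ) with hr
  set d : Fin 2 → ℝ := fun k => genieDist sel (α k) ρ with hd
  set C : ℝ := 2 * (1 + m ^ 2 * b ^ 2) + (|d 0| + |d 1|) with hC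
  have hC1 : 1 ≤ C := by
    have : 0 ≤ 2 * ((m : ℝ) ^ 2 * b ^ 2) + (|d 0| + |d 1|) := by positivity
    rw [hC]
    linarith
  set L : ℝ := 2 * (m * Tup : ℕ) + 1 with hL
  have hL0 : 0 < L := by positivity
  have hC0 : 0 < C := one_pos.trans_le hC1
  have hδ : C * (L * (ε / (4 * C * L))) = ε / 4 := by field_simp
  have hδ0 : 0 < ε / (4 * C * L) := by positivity
  -- The rate bound has constant `1 ≤ C`, so the same `δ` serves it.
  have hδ1 : 1 * (L * (ε / (4 * C * L))) ≤ ε / 4 := by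
    rw [← hδ]
    exact mul_le_mul_of_nonneg_right hC1 (by positivity)
  set η : ℝ := ε / (4 * (|(r 0 - r 1) / 2| + |(d 0 - d 1) / 2| + 1)) with hη
  have hη0 : 0 < η := by positivity
  have hηc : (|(r 0 - r 1) / 2| + |(d 0 - d 1) / 2| + 1) * η = ε / 4 := by
    rw [hη]; field_simp
  have hηr : |(r 0 - r 1) / 2| * η ≤ ε / 4 := by
    rw [← hηc]
    exact mul_le_mul_of_nonneg_right (by linarith [abs_nonneg ((d 0 - d 1) / 2)]) hη0.le
  have hηd : |(d 0 - d 1) / 2| * η ≤ ε / 4 := by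
    rw [← hηc]
    exact mul_le_mul_of_nonneg_right (by linarith [abs_nonneg ((r 0 - r 1) / 2)]) hη0.le
  refine ⟨ε / (4 * C * L), hδ0, fun p hp hp1 hpT t₀ ht₀ => ?_⟩
  have hpδ : 2 ≤ Tup → p ≤ ε / (4 * C * L) := fun h2 => by
    -- For `Tup ≥ 2` the exponent is at least `1`, so the assumption gives `1 - δ < 1 - p`.
    have : (1 - p) ^ (Tup - 1) ≤ (1 - p) ^ 1 :=
      pow_le_pow_of_le_one (by linarith) (by linarith) (by omega)
    linarith
  obtain ⟨b', hb'⟩ := exists_weight_bound w (t₀ ⟨m - 1, by omega⟩ + (m + 1) * Tup)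
  set S : ℝ := ((t₀ ⟨m - 1, by omega⟩ + (m + 1) * Tup : ℕ) : ℝ) with hS
  obtain ⟨N₁, hN₁, h₁⟩ := exists_horizon (C' := 1) (p := p) Tup S hε hδ1 hηr
  obtain ⟨N₂, hN₂, h₂⟩ := exists_horizon (C' := 2 * (1 + m ^ 2 * b' ^ 2) + (|d 0| + |d 1|))
    (p := p) Tup S hε hδ.le hηd
  refine ⟨max N₁ N₂, fun n hn Ω _ P _ θ Z X θhat t hc hX hs he => ?_⟩
  have hn1 : 1 ≤ n := hN₁.trans ((le_max_left _ _).trans hn)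
  have hn0 : (0 : ℝ) < n := by exact_mod_cast hn1
  have hT := one_le_greedyStep hsel hα hρ hs2
  have hrate : genieRate sel α ρ = r 0 / 2 + r 1 / 2 := by
    simp only [genieRate, hr]
    ring
  have hdist : genieDistortion sel α ρ = d 0 / 2 + d 1 / 2 := rfl
  have hR := integral_abs_samplingRate_sub_le hm ht₀ hT hTup hc hp hp1 hs he hn1 hδ0.le hpδ hη0
    (r := r) fun k => by rw [greedyStep_castSucc]
  have hD := integral_distortion_sub_le hm ht₀ hα hT hTup hc hp hp1 hX hs he hw hb hb'
    (d := d) (fun k => by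
      rw [greedyStep_castSucc]
      exact sum_range_genieStep sel (one_le_genieStep hsel (hα k) hρ)) hn1 hδ0.le hpδ hη0
  rw [hrate, hdist]
  exact ⟨hs.integrable_samplingRate hm n,
    le_of_mul_le_mul_left (hR.trans (h₁ n ((le_max_left _ _).trans hn))) hn0, hD.1,
    le_of_mul_le_mul_left (hD.2.trans (h₂ n ((le_max_right _ _).trans hn))) hn0⟩
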